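/- **Setting.** Let $I$ be a finite set of players. For each $i\in I$ let $\mathbb A^i$ and $\Theta^i$ be nonempty compact subsets of Euclidean spaces and $\mathbb Y^i$ a Borel subset of a Euclidean space; put $\mathbb A=\prod_{i}\mathbb A^i$, $\mathbb A^{-i}=\prod_{j\ne i}\mathbb A^j$, $\mathbb Y=\prod_i\mathbb Y^i$. For a space $X$, $\Delta X$ denotes the Borel probability measures on $X$ with the topology of weak convergence $\Rightarrow$. Player $i$ has a true consequence map $Q^i:\mathbb A\to\Delta\mathbb Y^i$, a parametric model $Q^i_\theta:\mathbb A\to\Delta\mathbb Y^i$ $(\theta\in\Theta^i)$, and a payoff $\pi^i:\mathbb A^i\times\mathbb Y^i\to\mathbb R$. Assume that for each $i$ there is a Borel measure $\nu^i$ on $\mathbb Y^i$ such that $Q^i(\cdot\mid a)$ and $Q^i_\theta(\cdot\mid a)$ have $\nu^i$-densities $q^i(\cdot\mid a)$ and $q^i_\theta(\cdot\mid a)$, where: * $(\theta,a,y)\mapsto q^i_\theta(y\mid a)$ is measurable, and for $\nu^i$-a.e. $y$ the maps $a\mapsto q^i(y\mid a)$, $(\theta,a)\mapsto q^i_\theta(y\mid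 a)$ and $x\mapsto\pi^i(x,y)$ are continuous ($\pi^i(x,\cdot)$ being $\nu^i$-measurable for each $x$); * there are measurable $M^i:\mathbb Y^i\to[1,\infty)$ and $r^i,h^i:\mathbb Y^i\to[0,\infty)$ such that, for all $(\theta,a)\in\Theta^i\times\mathbb A$, all $x\in\mathbb A^i$ and $\nu^i$-a.e. $y$, $q^i_\theta(y\mid a)/M^i(y)\le q^i(y\mid a)\le q^i_\theta(y\mid a)M^i(y)$, $q^i(y\mid a)\le r^i(y)$ and $|\pi^i(x,y)|\le h^i(y)$, and $\int M^ir^i\,d\nu^i<\infty$, $\int h^iM^ir^i\,d\nu^i<\infty$. **Rationalizability.** For $\mu\in\Delta\Theta^i$ and $\beta\in\Delta\mathbb A^{-i}$ let $$F^i(\mu,\beta)=\arg\max_{x\in\mathbb A^i}\int_{\Theta^i}\int_{\mathbb A^{-i}}\int_{\mathbb Y^i}\pi^i(x,y)\,Q^i_\theta(dy\mid x,b)\,\beta(db)\,\mu(d\theta).$$ Let $K^i(\theta,a)=\int\ln\frac{q^i(y\mid a)}{q^i_\theta(y\mid a)}\,q^i(y\mid a)\,\nu^i(dy)$ and, for $\sigma\in\Delta\mathbb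 A$, $\Theta^{m,i}(\sigma)=\arg\min_{\theta\in\Theta^i}\int K^i(\theta,a)\,\sigma(da)$; let $\sigma^{-i}$ be the marginal of $\sigma$ on $\mathbb A^{-i}$. For $A\subseteq\mathbb A$ let $\Gamma(A)$ be the set of $a\in\mathbb A$ for which there is $\sigma\in\Delta\mathbb A$ giving probability one to $A$ such that for every $i$ there is $\mu^i\in\Delta\Theta^i$ giving probability one to $\Theta^{m,i}(\sigma)$ with $a^i\in F^i(\mu^i,\sigma^{-i})$. A profile $a$ is *Berk–Nash rationalizable* if $a\in A\subseteq\Gamma(A)$ for some $A\subseteq\mathbb A$. **Dynamics.** Player $i$ has a prior $\mu_1^i\in\Delta\Theta^i$ with full support and a forecasting rule, that is, measurable maps $a_{1:t-1}\mapsto\tilde\sigma_t^{-i}\in\Delta\mathbb A^{-i}$, $t\ge1$. In each period $t=1,2,\dots$, given the history, the action profile $a_t$ is drawn from a joint law that depends on the history only through the players' current beliefs and forecasts and whose marginal for player $i$ is $\phi^i_t(\cdot\mid\mu^i_t,\tilde\sigma^{-i}_t)$, where $\phi^i_t$ is a Borel kernel with $\phi^i_t(F^i(\mu,\beta)\mid\mu,\beta)=1$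 for all $(\mu,\beta)$; then the consequences $y_t=(y^i_t)_i$ are drawn from a kernel $\mathbb A\to\Delta\mathbb Y$ evaluated at $a_t$ whose $i$-th marginal is $Q^i(\cdot\mid a_t)$; finally beliefs are updated by Bayes' rule (whose denominator is almost surely positive and finite), $$\mu^i_{t+1}(S)=\frac{\int_Sq^i_\theta(y^i_t\mid a_t)\,\mu^i_t(d\theta)}{\int_{\Theta^i}q^i_\theta(y^i_t\mid a_t)\,\mu^i_t(d\theta)}.$$ Let $\mathbf P_{\mathbb A^{\mathbb N}}$ be the resulting law of the action path $(a_t)_{t\ge1}$. The forecasting rules are assumed *pathwise subsequence consistent*: for every path $(a_t)_{t\ge 1}\in\mathbb A^{\mathbb N}$ and every subsequence $(t_k)$ along which the empirical distributions $\sigma_{t_k}=\frac1{t_k}\sum_{\tau\le t_k}\delta_{a_\tau}$ converge weakly to some $\sigma\in\Delta\mathbb A$, one has $\tilde\sigma^{-i}_{t_k}\Rightarrow\sigma^{-i}$ for all $i\in I$. **Theorem.** For $\mathbf P_{\mathbb A^{\mathbb N}}$-almost every path $(a_t)_{t\ge1}$, every limit action profile, that is, every $a\in\mathbb A$ with $a_{t_k}\to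 a$ along some subsequence $(t_k)$, is Berk–Nash rationalizable. -/

import Mathlib

open MeasureTheory ProbabilityTheory Filter Topology
open scoped NNReal ENNReal

namespace BerkNash

/-- An action profile `(aⁱ)_{i ∈ I}`. -/
abbrev Profile {I : Type*} (A : I → Type*) : Type _ := ∀ i, A i

/-- An action profile `a⁻ⁱ` of the opponents of player `i`. -/
abbrev Others {I : Type*} (A : I → Type*) (i : I) : Type _ := ∀ j : {j : I // j ≠ i}, A j

/-- The projection `a ↦ a⁻ⁱ`. -/
def others {I : Type*} {A : I → Type*} (i : I) (a : Profile A) : Others A i := fun j => a j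

/-- The profile `(aⁱ, a⁻ⁱ)` assembled from an action of player `i` and actions of the others. -/
def assemble {I : Type*} [DecidableEq I] {A : I → Type*} (i : I) (x : A i) (b : Others A i) :
    Profile A :=
  (Equiv.piSplitAt i A).symm (x, b)

lemma measurable_others {I : Type*} {A : I → Type*} [∀ i, MeasurableSpace (A i)] (i : I) :
    Measurable (others (A := A) i) :=
  measurable_pi_iff.2 fun j => measurable_pi_apply (j : I)

/-- The marginal `σ⁻ⁱ` of a distribution `σ` over action profiles on the opponents' actions. -/
noncomputable def marginalOthers {I : Type*} {A : I → Type*} [∀ i, MeasurableSpace (A i)] (i : I)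
    (σ : ProbabilityMeasure (Profile A)) : ProbabilityMeasure (Others A i) :=
  σ.map (measurable_others i).aemeasurable

/-- A simultaneous-move game in which every player holds a parametric, possibly misspecified, model
of how action profiles determine her consequences. Densities are with respect to `ν i`; their
relation to `Q` and `Qm` is part of `Game.Regular`. -/
structure Game {I : Type*} (A Y Θ : I → Type*) [∀ i, MeasurableSpace (A i)]
    [∀ i, MeasurableSpace (Y i)] [∀ i, MeasurableSpace (Θ i)] where
  /-- the true conditional law of player `i`'s consequence -/
  Q : ∀ i, Profile A → ProbabilityMeasure (Y i)
  /-- the law of player `i`'s consequence according to her model with parameter `θ` -/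
  Qm : ∀ i, Θ i → Profile A → ProbabilityMeasure (Y i)
  /-- payoffs, as functions of own action and own consequence -/
  payoff : ∀ i, A i → Y i → ℝ
  /-- dominating measures -/
  ν : ∀ i, Measure (Y i)
  /-- densities of `Q` -/
  q : ∀ i, Profile A → Y i → ℝ≥0
  /-- densities of `Qm` -/
  qm : ∀ i, Θ i → Profile A → Y i → ℝ≥0
  measurable_qm : ∀ i, Measurable fun p : Θ i × Profile A × Y i => qm i p.1 p.2.1 p.2.2

section Game

variable {I : Type*} {A Y Θ : I → Type*} [∀ i, MeasurableSpace (A i)]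
  [∀ i, MeasurableSpace (Y i)] [∀ i, MeasurableSpace (Θ i)]

/-- The standing assumptions on densities and payoffs. -/
structure Game.Regular [∀ i, TopologicalSpace (A i)] [∀ i, TopologicalSpace (Θ i)]
    (G : Game A Y Θ) : Prop where
  measurable_q : ∀ i a, Measurable (G.q i a)
  aemeasurable_payoff : ∀ i x, AEMeasurable (G.payoff i x) (G.ν i)
  density_Q : ∀ i a, (G.Q i a : Measure (Y i)) = (G.ν i).withDensity fun y => (G.q i a y : ℝ≥0∞)
  density_Qm : ∀ i θ a,
    (G.Qm i θ a : Measure (Y i)) = (G.ν i).withDensity fun y => (G.qm i θ a y : ℝ≥0∞)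
  continuous_q : ∀ i, ∀ᵐ y ∂G.ν i, Continuous fun a => G.q i a y
  continuous_qm : ∀ i, ∀ᵐ y ∂G.ν i, Continuous fun p : Θ i × Profile A => G.qm i p.1 p.2 y
  continuous_payoff : ∀ i, ∀ᵐ y ∂G.ν i, Continuous fun x => G.payoff i x y
  /-- the likelihood-ratio bound `M`, the density envelope `r` and the payoff envelope `h` -/
  envelopes : ∀ i, ∃ M r h : Y i → ℝ≥0, Measurable M ∧ Measurable r ∧ Measurable h ∧
    (∀ y, 1 ≤ M y) ∧
    (∀ θ a, ∀ᵐ y ∂G.ν i, G.qm i θ a y * (M y)⁻¹ ≤ G.q i a y ∧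
      G.q i a y ≤ G.qm i θ a y * M y ∧ G.q i a y ≤ r y) ∧
    ∫⁻ y, (M y : ℝ≥0∞) * r y ∂G.ν i < ∞ ∧
    (∀ x, ∀ᵐ y ∂G.ν i, |G.payoff i x y| ≤ h y) ∧
    ∫⁻ y, (h y : ℝ≥0∞) * M y * r y ∂G.ν i < ∞

variable (G : Game A Y Θ)

/-- Expected utility `Uⁱ(aⁱ, β⁻ⁱ, θⁱ)`. -/
noncomputable def Game.utility [DecidableEq I] (i : I) (x : A i)
    (β : ProbabilityMeasure (Others A i)) (θ : Θ i) : ℝ :=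
  ∫ b, ∫ y, G.payoff i x y ∂(G.Qm i θ (assemble i x b) : Measure (Y i))
    ∂(β : Measure (Others A i))

/-- The optimal action correspondence `Fⁱ(μⁱ, β⁻ⁱ)`. -/
def Game.bestResponse [DecidableEq I] (i : I) (μ : ProbabilityMeasure (Θ i))
    (β : ProbabilityMeasure (Others A i)) : Set (A i) :=
  {x | ∀ x', ∫ θ, G.utility i x' β θ ∂(μ : Measure (Θ i)) ≤
    ∫ θ, G.utility i x β θ ∂(μ : Measure (Θ i))}

/-- The Kullback-Leibler divergence `Kⁱ(θⁱ, a)` of the model `θⁱ` from the truth at `a`. -/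
noncomputable def Game.KL (i : I) (θ : Θ i) (a : Profile A) : ℝ :=
  ∫ y, Real.log ((G.q i a y : ℝ) / G.qm i θ a y) * G.q i a y ∂G.ν i

/-- The set `Θ^{m,i}(σ)` of best-fitting parameters of player `i`. -/
def Game.bestFit (i : I) (σ : ProbabilityMeasure (Profile A)) : Set (Θ i) :=
  {θ | ∀ θ', ∫ a, G.KL i θ a ∂(σ : Measure (Profile A)) ≤
    ∫ a, G.KL i θ' a ∂(σ : Measure (Profile A))}

/-- The operator `Γ`. -/
def Game.Gam [DecidableEq I] (S : Set (Profile A)) : Set (Profile A) :=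
  {a | ∃ σ : ProbabilityMeasure (Profile A), (∀ᵐ x ∂(σ : Measure (Profile A)), x ∈ S) ∧
    ∀ i, ∃ μ : ProbabilityMeasure (Θ i),
      (∀ᵐ θ ∂(μ : Measure (Θ i)), θ ∈ G.bestFit i σ) ∧
      a i ∈ G.bestResponse i μ (marginalOthers i σ)}

/-- Berk-Nash rationalizability of an action profile. -/
def Game.Rationalizable [DecidableEq I] (a : Profile A) : Prop :=
  ∃ S : Set (Profile A), a ∈ S ∧ S ⊆ G.Gam S

/-! ### Bayesian updating -/

/-- The probability that belief `μ` of player `i` assigns (as a density) to consequence `y`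
after profile `a`. -/
noncomputable def Game.evidence (i : I) (μ : ProbabilityMeasure (Θ i)) (a : Profile A) (y : Y i) :
    ℝ≥0∞ :=
  ∫⁻ θ, (G.qm i θ a y : ℝ≥0∞) ∂(μ : Measure (Θ i))

open Classical in
/-- Bayes' rule: `S ↦ ∫_S q_θ(y|a) μ(dθ) / ∫ q_θ(y|a) μ(dθ)`. Where this quotient is meaningless
(an event of probability zero under the standing assumptions) the belief is left unchanged. -/
noncomputable def Game.bayesMeasure (i : I) (μ : ProbabilityMeasure (Θ i)) (a : Profile A)
    (y : Y i) : Measure (Θ i) :=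
  if G.evidence i μ a y = 0 ∨ G.evidence i μ a y = ∞ then (μ : Measure (Θ i))
  else (G.evidence i μ a y)⁻¹ •
    (μ : Measure (Θ i)).withDensity fun θ => (G.qm i θ a y : ℝ≥0∞)

lemma Game.isProbabilityMeasure_bayesMeasure (i : I) (μ : ProbabilityMeasure (Θ i))
    (a : Profile A) (y : Y i) : IsProbabilityMeasure (G.bayesMeasure i μ a y) := by
  unfold Game.bayesMeasure
  split_ifs with h
  · infer_instance
  · push Not at h
    refine ⟨?_⟩
    rw [Measure.smul_apply, withDensity_apply _ MeasurableSet.univ, Measure.restrict_univ,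
      smul_eq_mul]
    exact ENNReal.inv_mul_cancel h.1 h.2

/-- The posterior belief of player `i` after observing `(a, y)` with prior belief `μ`. -/
noncomputable def Game.bayes (i : I) (μ : ProbabilityMeasure (Θ i)) (a : Profile A) (y : Y i) :
    ProbabilityMeasure (Θ i) :=
  ⟨G.bayesMeasure i μ a y, G.isProbabilityMeasure_bayesMeasure i μ a y⟩

lemma Game.measurable_bayes (i : I) :
    Measurable fun p : ProbabilityMeasure (Θ i) × Profile A × Y i =>
      G.bayes i p.1 p.2.1 p.2.2 := by
  let κ : Kernel (ProbabilityMeasure (Θ i) × Profile A × Y i) (Θ i) :=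
    ⟨fun p => (p.1 : Measure (Θ i)), measurable_subtype_coe.comp measurable_fst⟩
  have : IsMarkovKernel κ := ⟨fun p => inferInstanceAs (IsProbabilityMeasure (p.1 : Measure (Θ i)))⟩
  have hq : Measurable fun z : (ProbabilityMeasure (Θ i) × Profile A × Y i) × Θ i =>
      (G.qm i z.2 z.1.2.1 z.1.2.2 : ℝ≥0∞) := by
    have h1 : Measurable fun z : (ProbabilityMeasure (Θ i) × Profile A × Y i) × Θ i =>
        (z.2, z.1.2.1, z.1.2.2) := by fun_prop
    exact measurable_coe_nnreal_ennreal.comp ((G.measurable_qm i).comp h1)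
  have hev : Measurable fun p : ProbabilityMeasure (Θ i) × Profile A × Y i =>
      G.evidence i p.1 p.2.1 p.2.2 :=
    Measurable.lintegral_kernel_prod_right' (κ := κ) hq
  refine Measurable.subtype_mk ?_
  refine Measure.measurable_of_measurable_coe _ fun s hs => ?_
  have hμ : Measurable fun p : ProbabilityMeasure (Θ i) × Profile A × Y i =>
      (p.1 : Measure (Θ i)) s :=
    (Measure.measurable_coe hs).comp (measurable_subtype_coe.comp measurable_fst)
  have hint : Measurable fun p : ProbabilityMeasure (Θ i) × Profile A × Y i =>
      ∫⁻ θ in s, (G.qm i θ p.2.1 p.2.2 : ℝ≥0∞) ∂(p.1 : Measure (Θ i)) := by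
    have h2 : Measurable fun z : (ProbabilityMeasure (Θ i) × Profile A × Y i) × Θ i =>
        s.indicator (fun θ => (G.qm i θ z.1.2.1 z.1.2.2 : ℝ≥0∞)) z.2 :=
      hq.indicator (measurable_snd hs)
    have h3 := Measurable.lintegral_kernel_prod_right' (κ := κ) h2
    simpa only [lintegral_indicator hs] using! h3
  have hset : MeasurableSet {p : ProbabilityMeasure (Θ i) × Profile A × Y i |
      G.evidence i p.1 p.2.1 p.2.2 = 0 ∨ G.evidence i p.1 p.2.1 p.2.2 = ∞} :=
    (hev (measurableSet_singleton 0)).union (hev (measurableSet_singleton ∞))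
  have key := @Measurable.ite _ _ _ _ _ _ _ (Classical.decPred _) hset hμ (hev.inv.mul hint)
  convert key using 1
  funext p
  unfold Game.bayesMeasure
  split_ifs with h
  · rfl
  · rw [Measure.smul_apply, withDensity_apply _ hs, smul_eq_mul]
    rfl

/-! ### Play over time

Times are `0, 1, 2, …`; time `n` is the `(n+1)`-st period. -/

/-- What happens in one period: an action profile and a profile of consequences. -/
abbrev Outcome (A Y : I → Type*) : Type _ := Profile A × Profile Y

/-- The belief of player `i` after a history of `n` periods, starting from `prior`. -/
noncomputable def Game.posterior (i : I) (prior : ProbabilityMeasure (Θ i)) :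
    (n : ℕ) → (Fin n → Outcome A Y) → ProbabilityMeasure (Θ i)
  | 0, _ => prior
  | n + 1, h => G.bayes i (Game.posterior i prior n fun s => h s.castSucc)
      (h (Fin.last n)).1 ((h (Fin.last n)).2 i)

lemma Game.measurable_posterior (i : I) (prior : ProbabilityMeasure (Θ i)) (n : ℕ) :
    Measurable (G.posterior i prior n) := by
  induction n with
  | zero => exact measurable_const
  | succ n ih =>
    have h1 : Measurable fun h : Fin (n + 1) → Outcome A Y =>
        (fun s : Fin n => h s.castSucc) := by fun_prop
    have h2 : Measurable fun h : Fin (n + 1) → Outcome A Y => (h (Fin.last n)).1 := by fun_prop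
    have h3 : Measurable fun h : Fin (n + 1) → Outcome A Y => (h (Fin.last n)).2 i :=
      (measurable_pi_apply i).comp (measurable_snd.comp (measurable_pi_apply _))
    exact (G.measurable_bayes i).comp ((ih.comp h1).prodMk (h2.prodMk h3))

/-- The rules by which the game is played over time. -/
structure Dynamics (G : Game A Y Θ) where
  /-- players' prior beliefs about their parameters -/
  prior : ∀ i, ProbabilityMeasure (Θ i)
  /-- forecasting rules: past action profiles determine the forecast of the opponents' actions -/
  forecast : ∀ i (n : ℕ), (Fin n → Profile A) → ProbabilityMeasure (Others A i)
  measurable_forecast : ∀ i n, Measurable (forecast i n)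
  /-- the kernels `φ` from which the individual actions are drawn given belief and forecast -/
  choice : ∀ i, ℕ → Kernel (ProbabilityMeasure (Θ i) × ProbabilityMeasure (Others A i)) (A i)
  /-- the joint law of the action profile given everyone's belief and forecast; only its
  marginals are prescribed, so independent and correlated randomization are both covered -/
  jointChoice : ℕ → Kernel
    (∀ i, ProbabilityMeasure (Θ i) × ProbabilityMeasure (Others A i)) (Profile A)
  jointChoice_markov : ∀ n, IsMarkovKernel (jointChoice n)
  jointChoice_marginal : ∀ n b i, (jointChoice n b).map (fun a => a i) = choice i n (b i)
  /-- the joint law of the consequences given the action profile; only its marginals are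
  prescribed -/
  consequence : Kernel (Profile A) (Profile Y)
  consequence_markov : IsMarkovKernel consequence
  consequence_marginal : ∀ a i, (consequence a).map (fun y => y i) = (G.Q i a : Measure (Y i))

namespace Dynamics

variable {G} (D : Dynamics G)

/-- Each player's belief and forecast after a history of `n` periods. -/
noncomputable def mind (n : ℕ) (h : Fin n → Outcome A Y) :
    ∀ i, ProbabilityMeasure (Θ i) × ProbabilityMeasure (Others A i) :=
  fun i => (G.posterior i (D.prior i) n h, D.forecast i n fun s => (h s).1)

lemma measurable_mind (n : ℕ) : Measurable (D.mind n) := by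
  refine measurable_pi_iff.2 fun i => (G.measurable_posterior i (D.prior i) n).prodMk ?_
  have h1 : Measurable fun h : Fin n → Outcome A Y => (fun s => (h s).1) := by fun_prop
  exact (D.measurable_forecast i n).comp h1

/-- The conditional law of the outcome at time `n` given the history of the `n` earlier periods:
the action profile is drawn first, then the consequences. -/
noncomputable def step (n : ℕ) : Kernel (Fin n → Outcome A Y) (Outcome A Y) :=
  ((D.jointChoice n).comap (D.mind n) (D.measurable_mind n)) ⊗ₖ
    (Kernel.prodMkLeft (Fin n → Outcome A Y) D.consequence)

instance (n : ℕ) : IsMarkovKernel (D.step n) := by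
  have := D.jointChoice_markov n
  have := D.consequence_markov
  unfold step
  infer_instance

/-- The history of times `0, …, n` as a family indexed by `Fin (n + 1)`. -/
def toFin (n : ℕ) (h : Finset.Iic n → Outcome A Y) : Fin (n + 1) → Outcome A Y :=
  fun s => h ⟨s, Finset.mem_Iic.2 (Nat.lt_succ_iff.1 s.2)⟩

lemma measurable_toFin (n : ℕ) : Measurable (toFin (A := A) (Y := Y) n) :=
  measurable_pi_iff.2 fun _ => measurable_pi_apply _

/-- `step (n + 1)`, with histories indexed as in the Ionescu-Tulcea theorem. -/
noncomputable def stepIic (n : ℕ) : Kernel (Finset.Iic n → Outcome A Y) (Outcome A Y) :=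
  (D.step (n + 1)).comap (toFin n) (measurable_toFin n)

instance (n : ℕ) : IsMarkovKernel (D.stepIic n) := by
  unfold stepIic
  infer_instance

/-- The law of the infinite sequence of action profiles and consequences. -/
noncomputable def law : Measure (ℕ → Outcome A Y) :=
  Kernel.trajMeasure (X := fun _ => Outcome A Y) (D.step 0 Fin.elim0) D.stepIic

/-- The law of the infinite sequence of action profiles. -/
noncomputable def actionLaw : Measure (ℕ → Profile A) :=
  D.law.map fun ω n => (ω n).1

/-- Players are Bayesian: priors have full support and actions are drawn from best responses to
the current belief and forecast. -/
structure Bayesian [DecidableEq I] [∀ i, TopologicalSpace (Θ i)] (D : Dynamics G) : Prop where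
  full_support : ∀ i, (D.prior i : Measure (Θ i)).IsOpenPosMeasure
  optimal : ∀ i n μ β, D.choice i n (μ, β) (G.bestResponse i μ β) = 1

end Dynamics

end Game

/-- The empirical distribution of the action profiles at times `0, …, n`. -/
noncomputable def empirical {X : Type*} [MeasurableSpace X] (a : ℕ → X) (n : ℕ) :
    ProbabilityMeasure X :=
  ⟨((n + 1 : ℕ) : ℝ≥0∞)⁻¹ • ∑ s ∈ Finset.range (n + 1), Measure.dirac (a s), by
    refine ⟨?_⟩
    rw [Measure.smul_apply, Measure.finsetSum_apply]
    simp only [measure_univ, Finset.sum_const, Finset.card_range, nsmul_eq_mul, mul_one,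
      smul_eq_mul]
    exact ENNReal.inv_mul_cancel (by exact_mod_cast n.succ_ne_zero) (ENNReal.natCast_ne_top _)⟩

/-- Pathwise subsequence consistency of all players' forecasting rules: along every path and every
subsequence on which the empirical distributions converge weakly, the forecasts converge weakly to
the opponents' marginals of the limit. -/
def Dynamics.Consistent {I : Type*} [Countable I] {A Y Θ : I → Type*}
    [∀ i, MeasurableSpace (A i)] [∀ i, MeasurableSpace (Y i)] [∀ i, MeasurableSpace (Θ i)]
    [∀ i, TopologicalSpace (A i)] [∀ i, SecondCountableTopology (A i)]
    [∀ i, OpensMeasurableSpace (A i)] {G : Game A Y Θ} (D : Dynamics G) : Prop :=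
  ∀ (a : ℕ → Profile A) (τ : ℕ → ℕ), StrictMono τ → ∀ σ : ProbabilityMeasure (Profile A),
    Tendsto (fun k => empirical a (τ k)) atTop (𝓝 σ) →
    ∀ i, Tendsto (fun k => D.forecast i (τ k) fun s => a s) atTop (𝓝 (marginalOthers i σ))

/-- `z` is a limit (accumulation) point of the sequence `a`. -/
def IsLimitProfile {X : Type*} [TopologicalSpace X] (a : ℕ → X) (z : X) : Prop :=
  ∃ τ : ℕ → ℕ, StrictMono τ ∧ Tendsto (fun k => a (τ k)) atTop (𝓝 z)

end BerkNash

namespace BerkNash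

/-! On almost every path the set `S` of its own limit profiles satisfies `S ⊆ Γ(S)`. If `a_{t_k} →
x`, compactness gives a further subsequence along which the empirical distributions tend to some `σ`
and the beliefs to some `μⁱ`. A point outside `S` has a neighbourhood visited finitely often, so `σ`
lives on `S` (`ae_isLimitProfile`). Forecasts tend to `σ⁻ⁱ` by consistency. Actions are almost
surely optimal, and optimality survives the limit because expected payoffs are jointly continuous in
action, forecast and belief (`bestResponse_of_tendsto`).

It remains that `μⁱ` charges only best-fitting parameters (`ae_bestFit_of_tendsto`), a form of
Berk's theorem in which actions need not converge and `σ` depends on path and subsequence. Let `θ'`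
fit `σ` better than `θ`, and take small closed balls `C` near `θ` and `B` near `θ'`. Posterior odds
of `C` against `B` are at most the prior odds times `exp (∑ d_s)`, where `d_s` is the log of the
largest likelihood in `C` over the smallest in `B` (`posterior_mul_le`). Let `m(a)` be the true mean
of `exp (t d)` at `a`. Since `m ≤ exp (m - 1)`, the factors `exp (t d_s - (m(a_s) - 1))` have
conditional mean at most one, so their products are eventually below `exp (ε n)`
(`ae_eventually_prod_le`). Hence `t ∑ d_s ≤ ε n + ∑ (m(a_s) - 1)`, and by continuity of `m` the last
sum divided by `n` tends to `∫ (m - 1) dσ` along the subsequence. As `t → 0` and the balls shrink,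
`∫ (m - 1)/t dσ` tends to the divergence of `θ'` minus that of `θ`, which is negative
(`exists_integral_ratioMoment_lt`). So `∑ d_s → -∞` and the belief in `C` vanishes. Countably many
balls, `t` and `ε` suffice, so one null set serves every `σ` and every subsequence.

Likelihood ratios are only bounded by `M²`, whereas `M r` is what is assumed integrable; exponents
`t ≤ 1/4` bridge this gap. -/

/-- Almost sure statements about a random variable `f` on a standard Borel space transfer to the law
of `f`, even if they define a non-measurable set. -/
lemma ae_map_of_ae_comp {Ω X : Type*} [MeasurableSpace Ω] [StandardBorelSpace Ω]
    [MeasurableSpace X] [MeasurableEq X] {μ : Measure Ω} [IsProbabilityMeasure μ]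
    {f : Ω → X} (hf : Measurable f) {P : X → Prop} (h : ∀ᵐ ω ∂μ, P (f ω)) :
    ∀ᵐ x ∂μ.map f, P x := by
  have : Nonempty Ω := nonempty_of_isProbabilityMeasure μ
  -- The bad outcomes need not form a measurable set, so they are replaced by a measurable hull,
  -- which is still null.
  have hN : MeasurableSet {p : X × Ω | f p.2 = p.1 ∧ p.2 ∉ toMeasurable μ {ω | ¬ P (f ω)}} :=
    (measurableSet_eq_fun (hf.comp measurable_snd) measurable_fst).inter
      (measurable_snd (measurableSet_toMeasurable _ _).compl)
  have h1 : ∀ᵐ p ∂μ.map fun ω => (f ω, ω),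
      f p.2 = p.1 ∧ p.2 ∉ toMeasurable μ {ω | ¬ P (f ω)} := by
    rw [ae_map_iff (by fun_prop) hN]
    have : μ (toMeasurable μ {ω | ¬ P (f ω)}) = 0 := by
      rw [measure_toMeasurable]; exact h
    filter_upwards [measure_eq_zero_iff_ae_notMem.1 this] with ω hω
    exact ⟨rfl, hω⟩
  have h2 : μ.map f ⊗ₘ condDistrib id f μ = μ.map fun ω => (f ω, ω) :=
    compProd_map_condDistrib aemeasurable_id
  rw [← h2] at h1
  filter_upwards [Measure.ae_ae_of_ae_compProd h1] with x hx
  -- The conditional law given `f = x` is a probability measure carried by the good part of the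
  -- fibre, which is therefore nonempty.
  obtain ⟨ω, rfl, hω⟩ := hx.exists
  by_contra hP
  exact hω (subset_toMeasurable _ _ hP)

/-! ### The law of play: conditional laws and products with conditional mean at most one. -/

section Law

variable {I : Type*} {A Y Θ : I → Type*} [∀ i, MeasurableSpace (A i)]
  [∀ i, MeasurableSpace (Y i)] [∀ i, MeasurableSpace (Θ i)] {G : Game A Y Θ}

namespace Dynamics

variable (D : Dynamics G)

instance : IsProbabilityMeasure D.law := by
  unfold law
  infer_instance

/-- The conditional law of the outcome at time `n` given the earlier outcomes is `step n`. -/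
lemma map_law_history (n : ℕ) :
    D.law.map (fun ω => ((fun s : Fin n => ω s), ω n)) =
      (D.law.map fun ω (s : Fin n) => ω s) ⊗ₘ D.step n := by
  -- The first period comes from the initial measure of the trajectory; every later one comes from
  -- the Ionescu-Tulcea recursion, up to reindexing histories by `toFin`.
  cases n with
  | zero =>
    have h0 : D.law.map (fun ω => ω 0) = D.step 0 Fin.elim0 := by
      unfold law Kernel.trajMeasure
      rw [Measure.map_comp _ _ (by fun_prop)]
      have h1 : (Kernel.traj (X := fun _ => Outcome A Y) D.stepIic 0).map (fun ω => ω 0) =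
          Kernel.deterministic (fun h : Finset.Iic 0 → Outcome A Y => h ⟨0, by simp⟩)
            (by fun_prop) := by
        have h2 := Kernel.traj_map_frestrictLe (X := fun _ => Outcome A Y) (κ := D.stepIic) 0 0
        rw [Kernel.partialTraj_self] at h2
        have h3 : (fun ω : ℕ → Outcome A Y => ω 0) =
          (fun h : Finset.Iic 0 → Outcome A Y => h ⟨0, by simp⟩) ∘
            (Preorder.frestrictLe 0) := rfl
        rw [h3, Kernel.map_comp_right _ (Preorder.measurable_frestrictLe 0) (by fun_prop),
          h2, Kernel.id_map]
      rw [h1, Measure.deterministic_comp_eq_map, Measure.map_map (by fun_prop) (by fun_prop)]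
      convert Measure.map_id
      rfl
    have h3 : (D.law.map fun ω (s : Fin 0) => ω s) = Measure.dirac Fin.elim0 := by
      have : (fun (ω : ℕ → Outcome A Y) (s : Fin 0) => ω s) = fun _ => Fin.elim0 :=
        funext fun ω => Subsingleton.elim _ _
      rw [this, Measure.map_const, measure_univ, one_smul]
    ext s hs
    have hs' : MeasurableSet (Prod.mk (Fin.elim0 : Fin 0 → Outcome A Y) ⁻¹' s) :=
      measurable_prodMk_left hs
    rw [h3, Measure.compProd_apply hs, lintegral_dirac' _
      (Kernel.measurable_kernel_prodMk_left hs), ← h0, Measure.map_apply (by fun_prop) hs',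
      Measure.map_apply (by fun_prop) hs]
    congr 1
    ext ω
    have : (fun s : Fin 0 => ω s) = Fin.elim0 := Subsingleton.elim _ _
    simp only [Set.mem_preimage, this]
  | succ n =>
    have h := Kernel.map_frestrictLe_trajMeasure_compProd_eq_map_trajMeasure
      (X := fun _ => Outcome A Y) (μ₀ := D.step 0 Fin.elim0) (κ := D.stepIic) (a := n)
    change D.law.map _ ⊗ₘ _ = D.law.map _ at h
    have h1 : (D.law.map fun ω (s : Fin (n + 1)) => ω s) =
        (D.law.map (Preorder.frestrictLe n)).map (toFin n) := by
      rw [Measure.map_map (measurable_toFin n) (by fun_prop)]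
      rfl
    ext s hs
    have hm := measurable_toFin (A := A) (Y := Y) n
    have h2 := congrArg (fun μ => μ (Prod.map (toFin n) id ⁻¹' s)) h
    have hs' := (hm.prodMap measurable_id) hs
    rw [h1, Measure.compProd_apply hs, lintegral_map
      (Kernel.measurable_kernel_prodMk_left hs) hm, Measure.map_apply (by fun_prop) hs]
    rw [Measure.compProd_apply hs', Measure.map_apply (by fun_prop) hs'] at h2
    exact h2.symm

/-- What holds almost surely in each period, whatever the history, holds almost surely. -/
lemma ae_of_forall_step (n : ℕ) {P : (Fin n → Outcome A Y) → Outcome A Y → Prop}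
    (hP : MeasurableSet {p : (Fin n → Outcome A Y) × Outcome A Y | P p.1 p.2})
    (h : ∀ x, ∀ᵐ o ∂D.step n x, P x o) : ∀ᵐ ω ∂D.law, P (fun s => ω s) (ω n) := by
  have h1 : ∀ᵐ p ∂D.law.map (fun ω => ((fun s : Fin n => ω s), ω n)), P p.1 p.2 := by
    rw [map_law_history]
    exact Measure.ae_compProd_of_ae_ae hP (ae_of_all _ h)
  exact ae_of_ae_map (by fun_prop) h1

lemma lintegral_step (n : ℕ) (x : Fin n → Outcome A Y) {f : Outcome A Y → ℝ≥0∞}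
    (hf : Measurable f) :
    ∫⁻ o, f o ∂D.step n x = ∫⁻ a, ∫⁻ y, f (a, y) ∂D.consequence a
      ∂D.jointChoice n (D.mind n x) := by
  have := D.jointChoice_markov n
  have := D.consequence_markov
  unfold step
  rw [Kernel.lintegral_compProd _ _ _ hf]
  rfl

lemma lintegral_consequence (i : I) (a : Profile A) {f : Y i → ℝ≥0∞} (hf : Measurable f) :
    ∫⁻ y, f (y i) ∂D.consequence a = ∫⁻ y, f y ∂(G.Q i a : Measure (Y i)) := by
  rw [← D.consequence_marginal a i, lintegral_map hf (measurable_pi_apply i)]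

/-- Consequences almost surely fall in sets that have full measure under the true law. -/
lemma ae_consequence (i : I) {P : Profile A → Y i → Prop}
    (hP : MeasurableSet {p : Profile A × Y i | P p.1 p.2})
    (h : ∀ a, ∀ᵐ y ∂(G.Q i a : Measure (Y i)), P a y) :
    ∀ᵐ ω ∂D.law, ∀ n, P (ω n).1 ((ω n).2 i) := by
  rw [ae_all_iff]
  intro n
  have hm : Measurable fun o : Outcome A Y => (o.1, o.2 i) := by fun_prop
  have hP' : MeasurableSet {o : Outcome A Y | P o.1 (o.2 i)} := hm hP
  refine D.ae_of_forall_step n (P := fun _ o => P o.1 (o.2 i)) (measurable_snd hP') fun x => ?_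
  have := D.jointChoice_markov n
  have := D.consequence_markov
  unfold step
  rw [Kernel.ae_compProd_iff hP']
  refine ae_of_all _ fun a => ?_
  have h1 := h a
  rw [← D.consequence_marginal a i] at h1
  exact ae_of_ae_map (measurable_pi_apply i).aemeasurable h1

/-- Actions almost surely fall in sets to which the choice kernel always gives full measure. -/
lemma ae_choice (i : I) (n : ℕ)
    {P : ProbabilityMeasure (Θ i) × ProbabilityMeasure (Others A i) → A i → Prop}
    (hP : MeasurableSet
      {p : (ProbabilityMeasure (Θ i) × ProbabilityMeasure (Others A i)) × A i | P p.1 p.2})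
    (h : ∀ b, ∀ᵐ x ∂D.choice i n b, P b x) :
    ∀ᵐ ω ∂D.law, P (D.mind n (fun s => ω s) i) ((ω n).1 i) := by
  have hm : Measurable fun p : (Fin n → Outcome A Y) × Outcome A Y =>
      (D.mind n p.1 i, p.2.1 i) :=
    (((measurable_pi_apply i).comp (D.measurable_mind n)).comp measurable_fst).prodMk
      ((measurable_pi_apply i).comp (measurable_fst.comp measurable_snd))
  refine D.ae_of_forall_step n (P := fun x o => P (D.mind n x i) (o.1 i)) (hm hP) fun x => ?_
  have := D.jointChoice_markov n
  have := D.consequence_markov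
  unfold step
  have hm' : Measurable fun o : Outcome A Y => (D.mind n x i, o.1 i) := by fun_prop
  have hP' : MeasurableSet {o : Outcome A Y | P (D.mind n x i) (o.1 i)} := hm' hP
  rw [Kernel.ae_compProd_iff hP']
  have h1 := h (D.mind n x i)
  rw [← D.jointChoice_marginal n (D.mind n x) i] at h1
  have h2 := ae_of_ae_map (measurable_pi_apply i).aemeasurable h1
  rw [Kernel.comap_apply]
  filter_upwards [h2] with a ha
  exact ae_of_all _ fun _ => ha

/-- A product of nonnegative factors with conditional means at most one has mean at most one. -/
lemma lintegral_prod_le_one (i : I) {f : Profile A → Y i → ℝ≥0∞}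
    (hf : Measurable (Function.uncurry f))
    (h : ∀ a, ∫⁻ y, f a y ∂(G.Q i a : Measure (Y i)) ≤ 1) (n : ℕ) :
    ∫⁻ ω, ∏ s ∈ Finset.range n, f (ω s).1 ((ω s).2 i) ∂D.law ≤ 1 := by
  induction n with
  | zero => simp
  | succ n ih =>
    have hf1 : Measurable fun o : Outcome A Y => f o.1 (o.2 i) :=
      hf.comp (g := Function.uncurry f) (f := fun o : Outcome A Y => (o.1, o.2 i)) (by fun_prop)
    have hF : Measurable fun x : Fin n → Outcome A Y => ∏ s, f (x s).1 ((x s).2 i) :=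
      Finset.measurable_fun_prod _ fun s _ => hf1.comp (measurable_pi_apply s)
    have hm : Measurable fun p : (Fin n → Outcome A Y) × Outcome A Y =>
        (∏ s, f (p.1 s).1 ((p.1 s).2 i)) * f p.2.1 (p.2.2 i) :=
      (hF.comp measurable_fst).mul (hf1.comp measurable_snd)
    have h1 : ∫⁻ ω, ∏ s ∈ Finset.range (n + 1), f (ω s).1 ((ω s).2 i) ∂D.law =
        ∫⁻ p, (∏ s, f (p.1 s).1 ((p.1 s).2 i)) * f p.2.1 (p.2.2 i)
          ∂D.law.map (fun ω => ((fun s : Fin n => ω s), ω n)) := by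
      rw [lintegral_map hm (by fun_prop)]
      refine lintegral_congr fun ω => ?_
      rw [Finset.prod_range_succ, Finset.prod_range]
    rw [h1, map_law_history, Measure.lintegral_compProd hm]
    refine le_trans (lintegral_mono (g := fun x => ∏ s, f (x s).1 ((x s).2 i)) fun x => ?_) ?_
    · dsimp only
      rw [lintegral_const_mul _ hf1]
      refine mul_le_of_le_one_right' ?_
      rw [D.lintegral_step n x hf1]
      have := D.jointChoice_markov n
      refine le_trans (lintegral_mono (g := fun _ => 1) fun a => ?_) (by simp)
      exact (D.lintegral_consequence i a
        (hf.comp (by fun_prop : Measurable fun y => (a, y)))).le.trans (h a)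
    · rw [lintegral_map hF (by fun_prop)]
      refine le_trans (le_of_eq (lintegral_congr fun ω => ?_)) ih
      rw [Finset.prod_range]

/-- Such products almost surely grow subexponentially. -/
lemma ae_eventually_prod_le (i : I) {f : Profile A → Y i → ℝ≥0∞}
    (hf : Measurable (Function.uncurry f))
    (h : ∀ a, ∫⁻ y, f a y ∂(G.Q i a : Measure (Y i)) ≤ 1) {ε : ℝ} (hε : 0 < ε) :
    ∀ᵐ ω ∂D.law, ∀ᶠ n : ℕ in atTop,
      ∏ s ∈ Finset.range n, f (ω s).1 ((ω s).2 i) ≤ ENNReal.ofReal (Real.exp (ε * n)) := by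
  have hf1 : Measurable fun o : Outcome A Y => f o.1 (o.2 i) :=
    hf.comp (g := Function.uncurry f) (f := fun o : Outcome A Y => (o.1, o.2 i)) (by fun_prop)
  have hF : ∀ n, Measurable fun ω : ℕ → Outcome A Y =>
      ∏ s ∈ Finset.range n, f (ω s).1 ((ω s).2 i) := fun n =>
    Finset.measurable_fun_prod _ fun s _ => hf1.comp (measurable_pi_apply s)
  -- Markov's inequality gives geometric decay in `n`; Borel-Cantelli then concludes.
  have hb : ∀ n : ℕ, D.law {ω | ENNReal.ofReal (Real.exp (ε * n)) ≤
      ∏ s ∈ Finset.range n, f (ω s).1 ((ω s).2 i)} ≤ ENNReal.ofReal (Real.exp (-ε) ^ n) := by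
    intro n
    have hpos := Real.exp_pos (ε * n)
    refine (meas_ge_le_lintegral_div (hF n).aemeasurable
      (by simpa using hpos) ENNReal.ofReal_ne_top).trans ?_
    refine (ENNReal.div_le_div_right (D.lintegral_prod_le_one i hf h n) _).trans ?_
    rw [one_div, ← ENNReal.ofReal_inv_of_pos hpos, ← Real.exp_neg, ← Real.exp_nat_mul]
    refine ENNReal.ofReal_le_ofReal (Real.exp_le_exp.2 (by linarith))
  have hs : ∑' n : ℕ, D.law {ω | ENNReal.ofReal (Real.exp (ε * n)) ≤
      ∏ s ∈ Finset.range n, f (ω s).1 ((ω s).2 i)} ≠ ∞ := by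
    refine ne_top_of_le_ne_top ?_ (ENNReal.tsum_le_tsum hb)
    have hsum : Summable fun n : ℕ => Real.exp (-ε) ^ n :=
      summable_geometric_of_lt_one (Real.exp_pos _).le (by simpa using hε)
    rw [← ENNReal.ofReal_tsum_of_nonneg (fun n => by positivity) hsum]
    exact ENNReal.ofReal_ne_top
  filter_upwards [ae_eventually_notMem hs] with ω hω
  filter_upwards [hω] with n hn
  exact (not_le.1 hn).le

end Dynamics

end Law

/-! ### Dominated families of likelihoods and continuity of true expectations. -/

/-- Likelihoods `p θ` and true densities `q` that, for consequences in the full-measure set `S`, are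
continuous, within a factor `M` of each other and bounded by `r`, uniformly over parameters and
action profiles. -/
structure Dominated {X Y T : Type*} [TopologicalSpace X] [TopologicalSpace T] [MeasurableSpace X]
    [MeasurableSpace Y] [MeasurableSpace T] (ν : Measure Y) (q : X → Y → ℝ≥0)
    (p : T → X → Y → ℝ≥0) (M r : Y → ℝ≥0) (S : Set Y) : Prop where
  measurableSet : MeasurableSet S
  null_compl : ν Sᶜ = 0
  measurable_q : ∀ a, Measurable (q a)
  measurable_p : Measurable fun z : T × X × Y => p z.1 z.2.1 z.2.2
  measurable_M : Measurable M
  measurable_r : Measurable r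
  one_le : ∀ y, 1 ≤ M y
  continuous_q : ∀ y ∈ S, Continuous fun a => q a y
  continuous_p : ∀ y ∈ S, Continuous fun z : T × X => p z.1 z.2 y
  le_mul_q : ∀ y ∈ S, ∀ θ a, p θ a y ≤ q a y * M y
  q_le : ∀ y ∈ S, ∀ θ a, q a y ≤ p θ a y * M y
  q_le_r : ∀ y ∈ S, ∀ a, q a y ≤ r y
  lintegral_lt : ∫⁻ y, (M y : ℝ≥0∞) * r y ∂ν < ∞
  lintegral_q : ∀ a, ∫⁻ y, (q a y : ℝ≥0∞) ∂ν = 1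

namespace Dominated

variable {X Y T : Type*} [TopologicalSpace X] [TopologicalSpace T]
  [MeasurableSpace X] [MeasurableSpace Y] [MeasurableSpace T] {ν : Measure Y} {q : X → Y → ℝ≥0}
  {p : T → X → Y → ℝ≥0} {M r : Y → ℝ≥0} {S : Set Y}

lemma ae_mem (h : Dominated ν q p M r S) : ∀ᵐ y ∂ν, y ∈ S :=
  h.null_compl

lemma p_pos (h : Dominated ν q p M r S) {y : Y} (hy : y ∈ S) {a : X} (hq : q a y ≠ 0) (θ : T) :
    0 < p θ a y := by
  by_contra h0
  have h1 := h.q_le y hy θ a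
  rw [not_lt.1 h0 |>.antisymm zero_le, zero_mul] at h1
  exact hq (le_antisymm h1 zero_le)

lemma p_eq_zero (h : Dominated ν q p M r S) {y : Y} (hy : y ∈ S) {a : X} (hq : q a y = 0) (θ : T) :
    p θ a y = 0 := by
  have h1 := h.le_mul_q y hy θ a
  rw [hq, zero_mul] at h1
  exact le_antisymm h1 zero_le

lemma continuous_p_left (h : Dominated ν q p M r S) {y : Y} (hy : y ∈ S) (a : X) :
    Continuous fun θ => p θ a y :=
  (h.continuous_p y hy).comp (by fun_prop : Continuous fun θ : T => (θ, a))

lemma integrable_bound (h : Dominated ν q p M r S) (c : ℝ) :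
    Integrable (fun y => c * (M y * r y : ℝ)) ν := by
  have h1 : Integrable (fun y => ((M y * r y : ℝ≥0) : ℝ)) ν := by
    refine ⟨by have := h.measurable_M; have := h.measurable_r; fun_prop, ?_⟩
    rw [HasFiniteIntegral]
    simpa using h.lintegral_lt
  simpa using h1.const_mul c

/-- All dominations below have this format: growth at most `c * M` leaves the integrable bound `c *
M * r`. Nothing is asked of `g` where the true density vanishes, since log-likelihood ratios carry
no information there. -/
lemma norm_mul_le (h : Dominated ν q p M r S) {g c : ℝ} {y : Y} (hy : y ∈ S) {a : X}
    (hc : 0 ≤ c) (hg : q a y ≠ 0 → |g| ≤ c * M y) : ‖g * q a y‖ ≤ c * (M y * r y) := by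
  rw [norm_mul, Real.norm_eq_abs, Real.norm_of_nonneg (NNReal.coe_nonneg _)]
  by_cases hq : q a y = 0
  · rw [hq, NNReal.coe_zero, mul_zero]; positivity
  · calc |g| * q a y ≤ (c * M y) * r y :=
          mul_le_mul (hg hq) (h.q_le_r y hy a) (by positivity) (by positivity)
      _ = _ := by ring

lemma integrable_mul (h : Dominated ν q p M r S) {g : Y → ℝ} {c : ℝ} {a : X} (hc : 0 ≤ c)
    (hgm : Measurable g) (hgb : ∀ y ∈ S, q a y ≠ 0 → |g y| ≤ c * M y) :
    Integrable (fun y => g y * q a y) ν := by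
  refine (h.integrable_bound c).mono' ?_ ?_
  · have := h.measurable_q a
    fun_prop
  · filter_upwards [h.ae_mem] with y hy using h.norm_mul_le hy hc (hgb y hy)

lemma integrable_q (h : Dominated ν q p M r S) (a : X) : Integrable (fun y => (q a y : ℝ)) ν := by
  simpa using h.integrable_mul (g := fun _ => 1) (c := 1) (a := a) zero_le_one
    measurable_const fun y _ _ => by simpa using h.one_le y

lemma integral_q (h : Dominated ν q p M r S) (a : X) : ∫ y, (q a y : ℝ) ∂ν = 1 := by
  have h1 : ENNReal.ofReal (∫ y, (q a y : ℝ) ∂ν) = 1 := by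
    rw [ofReal_integral_eq_lintegral_ofReal (h.integrable_q a) (ae_of_all _ fun y => by positivity)]
    simpa using h.lintegral_q a
  simpa using h1

lemma norm_integral_le (h : Dominated ν q p M r S) {g : Y → ℝ} {c : ℝ} {a : X} (hc : 0 ≤ c)
    (hgb : ∀ y ∈ S, q a y ≠ 0 → |g y| ≤ c * M y) :
    ‖∫ y, g y * q a y ∂ν‖ ≤ ∫ y, c * (M y * r y : ℝ) ∂ν :=
  norm_integral_le_of_norm_le (h.integrable_bound c)
    (by filter_upwards [h.ae_mem] with y hy using h.norm_mul_le hy hc (hgb y hy))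

/-- Expectations under the true law are continuous in the action profile, for integrands that are
continuous where the density is positive. -/
lemma continuous_integral [FirstCountableTopology X] (h : Dominated ν q p M r S) {g : X → Y → ℝ}
    {c : ℝ} (hc : 0 ≤ c) (hgm : ∀ a, Measurable (g a))
    (hgc : ∀ y ∈ S, ∀ a, q a y ≠ 0 → ContinuousAt (fun a => g a y) a)
    (hgb : ∀ y ∈ S, ∀ a, q a y ≠ 0 → |g a y| ≤ c * M y) :
    Continuous fun a => ∫ y, g a y * q a y ∂ν := by
  refine continuous_iff_continuousAt.2 fun a => ?_
  refine continuousAt_of_dominated (bound := fun y => c * (M y * r y : ℝ))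
    (Eventually.of_forall fun a' => ?_) (Eventually.of_forall fun a' => ?_)
    (h.integrable_bound c) ?_
  · have := h.measurable_q a'
    have := hgm a'
    fun_prop
  · filter_upwards [h.ae_mem] with y hy using h.norm_mul_le hy hc (hgb y hy a')
  · filter_upwards [h.ae_mem] with y hy
    have hqc : Continuous fun a => (q a y : ℝ) :=
      NNReal.continuous_coe.comp (h.continuous_q y hy)
    by_cases hq : q a y = 0
    -- Where the density vanishes `g` may be discontinuous in the action, but the product is
    -- squeezed to zero by `c * M y * q a' y`.
    · have h0 : Tendsto (fun a' => c * M y * (q a' y : ℝ)) (𝓝 a) (𝓝 0) := by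
        have := (hqc.const_mul (c * M y)).tendsto a
        simpa [hq] using this
      rw [ContinuousAt, hq, NNReal.coe_zero, mul_zero]
      refine squeeze_zero_norm (fun a' => ?_) h0
      rw [norm_mul, Real.norm_eq_abs, Real.norm_of_nonneg (NNReal.coe_nonneg _)]
      by_cases hq' : q a' y = 0
      · simp [hq']
      · exact mul_le_mul_of_nonneg_right (hgb y hy a' hq') (by positivity)
    · exact (hgc y hy a hq).mul hqc.continuousAt

/-- Dominated convergence for expectations under the true law, averaged over action profiles. -/
lemma tendsto_integral_integral (h : Dominated ν q p M r S) (σ : Measure X)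
    [IsFiniteMeasure σ] {g : ℕ → X → Y → ℝ} {g' : X → Y → ℝ} {c : ℝ} (hc : 0 ≤ c)
    (hgm : ∀ n a, Measurable (g n a))
    (hgm' : ∀ n, AEStronglyMeasurable (fun a => ∫ y, g n a y * q a y ∂ν) σ)
    (hgb : ∀ n, ∀ y ∈ S, ∀ a, q a y ≠ 0 → |g n a y| ≤ c * M y)
    (hg : ∀ y ∈ S, ∀ a, q a y ≠ 0 → Tendsto (fun n => g n a y) atTop (𝓝 (g' a y))) :
    Tendsto (fun n => ∫ a, ∫ y, g n a y * q a y ∂ν ∂σ) atTop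
      (𝓝 (∫ a, ∫ y, g' a y * q a y ∂ν ∂σ)) := by
  refine tendsto_integral_of_dominated_convergence
    (fun _ => ∫ y, c * (M y * r y : ℝ) ∂ν) hgm' (integrable_const _) (fun n => ae_of_all _ fun a =>
      h.norm_integral_le hc fun y hy => hgb n y hy a) (ae_of_all _ fun a => ?_)
  refine tendsto_integral_of_dominated_convergence
    (fun y => c * (M y * r y : ℝ)) (fun n => ?_) (h.integrable_bound c) (fun n => ?_) ?_
  · have := h.measurable_q a
    have := hgm n a
    fun_prop
  · filter_upwards [h.ae_mem] with y hy using h.norm_mul_le hy hc (hgb n y hy a)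
  · filter_upwards [h.ae_mem] with y hy
    by_cases hq : q a y = 0
    · simp [hq]
    · exact (hg y hy a hq).mul_const _

lemma abs_log_div_le (h : Dominated ν q p M r S) {y : Y} (hy : y ∈ S) {a : X} (hq : q a y ≠ 0)
    (θ : T) : |Real.log (q a y / p θ a y)| ≤ Real.log (M y) := by
  have hp : (0 : ℝ) < p θ a y := by exact_mod_cast h.p_pos hy hq θ
  have hq0 : (0 : ℝ) < q a y := by exact_mod_cast pos_iff_ne_zero.2 hq
  have hM : (0 : ℝ) < M y := lt_of_lt_of_le one_pos (by exact_mod_cast h.one_le y)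
  have h1 : (q a y : ℝ) ≤ p θ a y * M y := by exact_mod_cast h.q_le y hy θ a
  have h2 : (p θ a y : ℝ) ≤ q a y * M y := by exact_mod_cast h.le_mul_q y hy θ a
  rw [Real.log_div hq0.ne' hp.ne', abs_le]
  have h3 := Real.log_le_log hq0 h1
  have h4 := Real.log_le_log hp h2
  rw [Real.log_mul hp.ne' hM.ne'] at h3
  rw [Real.log_mul hq0.ne' hM.ne'] at h4
  constructor <;> linarith

lemma abs_log_sub_log_le (h : Dominated ν q p M r S) {y : Y} (hy : y ∈ S) {a : X}
    (hq : q a y ≠ 0) (θ θ' : T) :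
    |Real.log (p θ a y) - Real.log (p θ' a y)| ≤ 2 * Real.log (M y) := by
  have hq0 : (q a y : ℝ) ≠ 0 := by exact_mod_cast hq
  have h1 := h.abs_log_div_le hy hq θ
  have h2 := h.abs_log_div_le hy hq θ'
  rw [Real.log_div hq0 (by exact_mod_cast (h.p_pos hy hq _).ne')] at h1 h2
  rw [abs_le] at *
  constructor <;> linarith

/-- Brings logarithmic bounds into the format `c * M` used for domination. -/
lemma log_M_le (h : Dominated ν q p M r S) (y : Y) : Real.log (M y) ≤ 1 * M y := by
  have := Real.log_le_sub_one_of_pos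
    (lt_of_lt_of_le one_pos (by exact_mod_cast h.one_le y) : (0 : ℝ) < M y)
  linarith

/-- The Kullback-Leibler divergence is continuous in the action profile. -/
lemma continuous_kl [FirstCountableTopology X] (h : Dominated ν q p M r S) (θ : T) :
    Continuous fun a => ∫ y, Real.log (q a y / p θ a y) * q a y ∂ν := by
  refine h.continuous_integral zero_le_one (fun a => ?_) (fun y hy a hq => ?_)
    fun y hy a hq => (h.abs_log_div_le hy hq θ).trans (h.log_M_le y)
  · have h1 := h.measurable_q a
    have h2 : Measurable fun y => p θ a y := h.measurable_p.comp (by fun_prop :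
      Measurable fun y : Y => (θ, a, y))
    exact Real.measurable_log.comp (h1.coe_nnreal_real.div h2.coe_nnreal_real)
  · have hp : (p θ a y : ℝ) ≠ 0 := by exact_mod_cast (h.p_pos hy hq θ).ne'
    have hq0 : (q a y : ℝ) ≠ 0 := by exact_mod_cast hq
    have h1 : Continuous fun a => (q a y : ℝ) := NNReal.continuous_coe.comp (h.continuous_q y hy)
    have h2 : Continuous fun a => (p θ a y : ℝ) := NNReal.continuous_coe.comp
      ((h.continuous_p y hy).comp (by fun_prop : Continuous fun a : X => (θ, a)))
    exact (h1.continuousAt.div h2.continuousAt hp).log (div_ne_zero hq0 hp)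

end Dominated

/-! ### Extremal log-likelihood ratios over sets of parameters. -/

/-- The logarithm of the ratio of the largest likelihood in `C` to the smallest likelihood in `B`,
for consequences in `S`. -/
noncomputable def logRatio {X Y T : Type*} (p : T → X → Y → ℝ≥0) (S : Set Y) (C B : Set T) (a : X)
    (y : Y) : ℝ :=
  S.indicator (fun y => Real.log (sSup ((fun θ => p θ a y) '' C) : ℝ≥0) -
    Real.log (sInf ((fun θ => p θ a y) '' B) : ℝ≥0)) y

/-- `(eˣ - 1)/t` lies between `d` and `d eˣ` for `x = t d`. -/
lemma exp_sub_one_div_mem (d : ℝ) {t : ℝ} (ht : 0 < t) :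
    d ≤ (Real.exp (t * d) - 1) / t ∧ (Real.exp (t * d) - 1) / t ≤ d * Real.exp (t * d) := by
  rw [le_div_iff₀ ht, div_le_iff₀ ht]
  refine ⟨by linarith [Real.add_one_le_exp (t * d)], ?_⟩
  -- Multiplying `1 - t d ≤ exp (-t d)` by `exp (t d)` gives the upper bound.
  have h1 := Real.add_one_le_exp (-(t * d))
  have h2 : Real.exp (-(t * d)) * Real.exp (t * d) = 1 := by rw [← Real.exp_add]; simp
  nlinarith [Real.exp_pos (t * d)]

/-- The bound on `t` makes `exp (t d) ≤ exp (L/2)`, and `2 L ≤ 4 exp (L/2)` absorbs the factor `d`.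
With `L = log M` the difference quotient is then at most `4 M`, although `exp d` itself may be as
large as `M²`. -/
lemma abs_exp_sub_one_div_le {d L t : ℝ} (hd : |d| ≤ 2 * L) (ht : 0 < t) (ht' : t ≤ 1 / 4) :
    |(Real.exp (t * d) - 1) / t| ≤ 4 * Real.exp L := by
  obtain ⟨h1, h2⟩ := exp_sub_one_div_mem d ht
  have hL : 0 ≤ L := by linarith [abs_nonneg d]
  have hhalf : Real.exp (L / 2) * Real.exp (L / 2) = Real.exp L := by
    rw [← Real.exp_add]; ring_nf
  have h3 := Real.add_one_le_exp (L / 2)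
  have h4 : Real.exp (t * d) ≤ Real.exp (L / 2) := by
    refine Real.exp_le_exp.2 ?_
    have : t * d ≤ t * (2 * L) := mul_le_mul_of_nonneg_left ((le_abs_self d).trans hd) ht.le
    nlinarith
  have h5 : 1 ≤ Real.exp (L / 2) := Real.one_le_exp (by linarith)
  rw [abs_le] at hd ⊢
  constructor
  · nlinarith
  · refine h2.trans ((mul_le_mul_of_nonneg_right hd.2 (Real.exp_pos _).le).trans ?_)
    refine (mul_le_mul_of_nonneg_left h4 (by linarith)).trans ?_
    nlinarith

/-- Countable suprema keep the extremal likelihoods jointly measurable in action and consequence. -/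
lemma sSup_eq_iSup_denseSeq {T : Type*} [TopologicalSpace T] {C : Set T}
    {f : T → ℝ≥0} (hf : Continuous f) (hC : IsCompact C)
    [Nonempty C] [TopologicalSpace.SeparableSpace C] :
    sSup (f '' C) = ⨆ n, f (TopologicalSpace.denseSeq C n) := by
  have hb := (hC.image hf).bddAbove
  have hb' : BddAbove (Set.range fun n => f (TopologicalSpace.denseSeq C n)) :=
    hb.mono (by rintro _ ⟨n, rfl⟩; exact ⟨_, (TopologicalSpace.denseSeq C n).2, rfl⟩)
  refine le_antisymm (csSup_le ((Set.nonempty_coe_sort.1 ‹_›).image f) ?_)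
    (ciSup_le fun n => le_csSup hb ⟨_, (TopologicalSpace.denseSeq C n).2, rfl⟩)
  rintro _ ⟨θ, hθ, rfl⟩
  have hcl : IsClosed {θ : C | f θ ≤ ⨆ n, f (TopologicalSpace.denseSeq C n)} :=
    isClosed_le (hf.comp continuous_subtype_val) continuous_const
  have := (TopologicalSpace.denseRange_denseSeq C).closure_eq ▸
    hcl.closure_subset_iff.2 (by rintro _ ⟨n, rfl⟩; exact le_ciSup hb' n)
  exact this (Set.mem_univ (⟨θ, hθ⟩ : C))

lemma sInf_eq_iInf_denseSeq {T : Type*} [TopologicalSpace T] {C : Set T}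
    {f : T → ℝ≥0} (hf : Continuous f)
    [Nonempty C] [TopologicalSpace.SeparableSpace C] :
    sInf (f '' C) = ⨅ n, f (TopologicalSpace.denseSeq C n) := by
  refine le_antisymm
    (le_ciInf fun n => csInf_le (OrderBot.bddBelow _) ⟨_, (TopologicalSpace.denseSeq C n).2, rfl⟩)
    (le_csInf ((Set.nonempty_coe_sort.1 ‹_›).image f) ?_)
  rintro _ ⟨θ, hθ, rfl⟩
  have hcl : IsClosed {θ : C | ⨅ n, f (TopologicalSpace.denseSeq C n) ≤ f θ} :=
    isClosed_le continuous_const (hf.comp continuous_subtype_val)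
  have := (TopologicalSpace.denseRange_denseSeq C).closure_eq ▸
    hcl.closure_subset_iff.2 (by
      rintro _ ⟨n, rfl⟩
      exact ciInf_le (f := fun n => f (TopologicalSpace.denseSeq C n)) (OrderBot.bddBelow _) n)
  exact this (Set.mem_univ ⟨θ, hθ⟩)

namespace Dominated

variable {X Y T : Type*} [TopologicalSpace X] [TopologicalSpace T]
  [MeasurableSpace X] [MeasurableSpace Y] [MeasurableSpace T] {ν : Measure Y} {q : X → Y → ℝ≥0}
  {p : T → X → Y → ℝ≥0} {M r : Y → ℝ≥0} {S : Set Y} {C B : Set T}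

lemma measurable_logRatio [TopologicalSpace.PseudoMetrizableSpace T] [SecondCountableTopology T]
    (h : Dominated ν q p M r S)
    (hC : IsCompact C) (hC' : C.Nonempty) (hB' : B.Nonempty) :
    Measurable (Function.uncurry (logRatio p S C B)) := by
  have := hC'.to_subtype
  have := hB'.to_subtype
  have h1 : Function.uncurry (logRatio p S C B) = (Prod.snd ⁻¹' S).indicator fun z : X × Y =>
      Real.log (⨆ n, p (TopologicalSpace.denseSeq C n) z.1 z.2 : ℝ≥0) -
        Real.log (⨅ n, p (TopologicalSpace.denseSeq B n) z.1 z.2 : ℝ≥0) := by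
    funext ⟨a, y⟩
    by_cases hy : y ∈ S
    · simp only [Function.uncurry, logRatio, Set.indicator_of_mem hy,
        Set.indicator_of_mem (show (a, y) ∈ Prod.snd ⁻¹' S from hy),
        sSup_eq_iSup_denseSeq (h.continuous_p_left hy a) hC,
        sInf_eq_iInf_denseSeq (h.continuous_p_left hy a)]
    · simp [logRatio, hy]
  rw [h1]
  refine Measurable.indicator ?_ (measurable_snd h.measurableSet)
  have hm : ∀ θ : T, Measurable fun z : X × Y => p θ z.1 z.2 := fun θ =>
    h.measurable_p.comp (by fun_prop : Measurable fun z : X × Y => (θ, z.1, z.2))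
  exact (Real.measurable_log.comp (Measurable.iSup fun n => hm _).coe_nnreal_real).sub
    (Real.measurable_log.comp (Measurable.iInf fun n => hm _).coe_nnreal_real)

/-- Compactness makes both extrema attained, so pointwise bounds for two parameters carry over to
sets. -/
lemma exists_logRatio_eq (h : Dominated ν q p M r S) (hC : IsCompact C) (hC' : C.Nonempty)
    (hB : IsCompact B) (hB' : B.Nonempty) {y : Y} (hy : y ∈ S) (a : X) :
    ∃ θ ∈ C, ∃ θ' ∈ B, sSup ((fun θ => p θ a y) '' C) = p θ a y ∧
      sInf ((fun θ => p θ a y) '' B) = p θ' a y ∧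
      logRatio p S C B a y = Real.log (p θ a y) - Real.log (p θ' a y) := by
  have hc := (h.continuous_p_left hy a)
  obtain ⟨θ, hθ, h1⟩ := hC.exists_sSup_image_eq hC' hc.continuousOn
  obtain ⟨θ', hθ', h2⟩ := hB.exists_sInf_image_eq hB' hc.continuousOn
  exact ⟨θ, hθ, θ', hθ', h1, h2, by
    simp only [logRatio, Set.indicator_of_mem hy, h1, h2]⟩

/-- Likelihoods in `C` are bounded by `exp logRatio` times a lower bound of those in `B`. -/
lemma exists_bounds (h : Dominated ν q p M r S) (hC : IsCompact C) (hC' : C.Nonempty)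
    (hB : IsCompact B) (hB' : B.Nonempty) {y : Y} (hy : y ∈ S) {a : X} (hq : q a y ≠ 0) :
    ∃ u v : ℝ≥0, (∀ θ ∈ C, p θ a y ≤ u) ∧ (∀ θ ∈ B, v ≤ p θ a y) ∧
      (u : ℝ≥0∞) = ENNReal.ofReal (Real.exp (logRatio p S C B a y)) * v := by
  have hc := h.continuous_p_left hy a
  obtain ⟨θ₁, hθ₁, θ₂, hθ₂, h1, h2, h3⟩ := h.exists_logRatio_eq hC hC' hB hB' hy a
  have hp₁ : (0 : ℝ) < p θ₁ a y := by exact_mod_cast h.p_pos hy hq _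
  have hp₂ : (0 : ℝ) < p θ₂ a y := by exact_mod_cast h.p_pos hy hq _
  refine ⟨p θ₁ a y, p θ₂ a y, fun θ hθ => ?_, fun θ hθ => ?_, ?_⟩
  · rw [← h1]
    exact le_csSup (hC.image hc).bddAbove ⟨θ, hθ, rfl⟩
  · rw [← h2]
    exact csInf_le (OrderBot.bddBelow _) ⟨θ, hθ, rfl⟩
  · rw [h3, Real.exp_sub, Real.exp_log hp₁, Real.exp_log hp₂, ← ENNReal.ofReal_coe_nnreal,
      ← ENNReal.ofReal_coe_nnreal, ← ENNReal.ofReal_mul (by positivity)]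
    congr 1
    field_simp

lemma abs_logRatio_le (h : Dominated ν q p M r S) (hC : IsCompact C) (hC' : C.Nonempty)
    (hB : IsCompact B) (hB' : B.Nonempty) {y : Y} (hy : y ∈ S) {a : X} (hq : q a y ≠ 0) :
    |logRatio p S C B a y| ≤ 2 * Real.log (M y) := by
  obtain ⟨θ₁, -, θ₂, -, -, -, h3⟩ := h.exists_logRatio_eq hC hC' hB hB' hy a
  rw [h3]
  exact h.abs_log_sub_log_le hy hq _ _

lemma continuousAt_logRatio (h : Dominated ν q p M r S) (hC : IsCompact C) (hC' : C.Nonempty)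
    (hB : IsCompact B) (hB' : B.Nonempty) {y : Y} (hy : y ∈ S) {a : X} (hq : q a y ≠ 0) :
    ContinuousAt (fun a => logRatio p S C B a y) a := by
  obtain ⟨θ₁, -, θ₂, -, h1, h2, h3⟩ := h.exists_logRatio_eq hC hC' hB hB' hy a
  simp only [logRatio, Set.indicator_of_mem hy]
  have hc : Continuous (fun z : X × T => p z.2 z.1 y) := (h.continuous_p y hy).comp continuous_swap
  refine ContinuousAt.sub (ContinuousAt.log ?_ ?_) (ContinuousAt.log ?_ ?_)
  · exact (NNReal.continuous_coe.comp
      (hC.continuous_sSup (f := fun a θ => p θ a y) hc)).continuousAt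
  · rw [h1]; exact_mod_cast (h.p_pos hy hq _).ne'
  · exact (NNReal.continuous_coe.comp
      (hB.continuous_sInf (f := fun a θ => p θ a y) hc)).continuousAt
  · rw [h2]; exact_mod_cast (h.p_pos hy hq _).ne'

/-- The extremal parameters lie in the shrinking sets and so converge to `θ` and `θ'`; continuity of
the likelihood does the rest. -/
lemma tendsto_logRatio (h : Dominated ν q p M r S) {Cs Bs : ℕ → Set T}
    (hC : ∀ n, IsCompact (Cs n)) (hC' : ∀ n, (Cs n).Nonempty)
    (hB : ∀ n, IsCompact (Bs n)) (hB' : ∀ n, (Bs n).Nonempty) {θ θ' : T}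
    (hCs : Tendsto Cs atTop (𝓝 θ).smallSets) (hBs : Tendsto Bs atTop (𝓝 θ').smallSets)
    {y : Y} (hy : y ∈ S) {a : X} (hq : q a y ≠ 0) :
    Tendsto (fun n => logRatio p S (Cs n) (Bs n) a y) atTop
      (𝓝 (Real.log (p θ a y) - Real.log (p θ' a y))) := by
  choose u hu v hv _ _ h3 using fun n => h.exists_logRatio_eq (hC n) (hC' n) (hB n) (hB' n) hy a
  simp only [h3]
  have hc : Continuous fun θ => (p θ a y : ℝ) :=
    NNReal.continuous_coe.comp (h.continuous_p_left hy a)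
  have hut : Tendsto u atTop (𝓝 θ) := fun U hU =>
    (tendsto_smallSets_iff.1 hCs U hU).mono fun n hn => hn (hu n)
  have hvt : Tendsto v atTop (𝓝 θ') := fun U hU =>
    (tendsto_smallSets_iff.1 hBs U hU).mono fun n hn => hn (hv n)
  exact (((hc.tendsto θ).comp hut).log (by exact_mod_cast (h.p_pos hy hq _).ne')).sub
    (((hc.tendsto θ').comp hvt).log (by exact_mod_cast (h.p_pos hy hq _).ne'))

lemma abs_moment_sub_one_le (h : Dominated ν q p M r S) (hC : IsCompact C) (hC' : C.Nonempty)
    (hB : IsCompact B) (hB' : B.Nonempty) {t : ℝ} (ht : 0 < t) (ht' : t ≤ 1 / 4)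
    {y : Y} (hy : y ∈ S) {a : X} (hq : q a y ≠ 0) :
    |(Real.exp (t * logRatio p S C B a y) - 1) / t| ≤ 4 * M y := by
  have hM : (0 : ℝ) < M y := lt_of_lt_of_le one_pos (by exact_mod_cast h.one_le y)
  have := abs_exp_sub_one_div_le (h.abs_logRatio_le hC hC' hB hB' hy hq) ht ht'
  rwa [Real.exp_log hM] at this

end Dominated

/-! ### Exponential moments of the likelihood ratio. -/

/-- The expectation, under the true law, of `exp (t * logRatio)`. -/
noncomputable def ratioMoment {X Y T : Type*} [MeasurableSpace Y] (ν : Measure Y)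
    (q : X → Y → ℝ≥0) (p : T → X → Y → ℝ≥0) (S : Set Y) (t : ℝ) (C B : Set T) (a : X) : ℝ :=
  ∫ y, Real.exp (t * logRatio p S C B a y) * q a y ∂ν

namespace Dominated

variable {X Y T : Type*} [TopologicalSpace X] [TopologicalSpace T]
  [MeasurableSpace X] [MeasurableSpace Y] [MeasurableSpace T] {ν : Measure Y} {q : X → Y → ℝ≥0}
  {p : T → X → Y → ℝ≥0} {M r : Y → ℝ≥0} {S : Set Y} {C B : Set T}
  [TopologicalSpace.PseudoMetrizableSpace T] [SecondCountableTopology T]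

lemma measurable_logRatio_right (h : Dominated ν q p M r S) (hC : IsCompact C) (hC' : C.Nonempty)
    (hB' : B.Nonempty) (a : X) : Measurable (logRatio p S C B a) :=
  (h.measurable_logRatio hC hC' hB').comp (by fun_prop : Measurable fun y : Y => (a, y))

lemma integrable_moment (h : Dominated ν q p M r S) (hC : IsCompact C) (hC' : C.Nonempty)
    (hB : IsCompact B) (hB' : B.Nonempty) {t : ℝ} (ht : 0 < t) (ht' : t ≤ 1 / 4)
    (a : X) :
    Integrable (fun y => Real.exp (t * logRatio p S C B a y) * q a y) ν := by
  -- The difference quotient bound gives `exp (t * logRatio) ≤ 1 + 4 t M ≤ 1 + M`, so the constant 5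
  -- is ample.
  refine h.integrable_mul (c := 5) (by norm_num) ?_ fun y hy hq => ?_
  · have := measurable_logRatio_right h hC hC' hB' a
    fun_prop
  · have h1 := abs_moment_sub_one_le h hC hC' hB hB' ht ht' hy hq
    have h2 : (1 : ℝ) ≤ M y := by exact_mod_cast h.one_le y
    rw [abs_div, abs_of_pos ht, div_le_iff₀ ht, abs_le] at h1
    rw [abs_of_pos (Real.exp_pos _)]
    nlinarith [h1.2]

/-- The true density integrates to one, so the subtraction can be moved inside the integral, where
the bound `4 * M` is available uniformly in `t`. -/
lemma ratioMoment_sub_one_div (h : Dominated ν q p M r S) (hC : IsCompact C) (hC' : C.Nonempty)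
    (hB : IsCompact B) (hB' : B.Nonempty) {t : ℝ} (ht : 0 < t) (ht' : t ≤ 1 / 4)
    (a : X) : (ratioMoment ν q p S t C B a - 1) / t =
    ∫ y, (Real.exp (t * logRatio p S C B a y) - 1) / t * q a y ∂ν := by
  have h1 := integral_sub (integrable_moment h hC hC' hB hB' ht ht' a) (h.integrable_q a)
  rw [h.integral_q a] at h1
  rw [ratioMoment, ← h1, ← integral_div]
  congr 1
  funext y
  ring

lemma continuous_ratioMoment (h : Dominated ν q p M r S) (hC : IsCompact C) (hC' : C.Nonempty)
    (hB : IsCompact B) (hB' : B.Nonempty) {t : ℝ} (ht : 0 < t) (ht' : t ≤ 1 / 4)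
    [FirstCountableTopology X] :
    Continuous (ratioMoment ν q p S t C B) := by
  have h1 : Continuous fun a => (ratioMoment ν q p S t C B a - 1) / t := by
    simp only [ratioMoment_sub_one_div h hC hC' hB hB' ht ht']
    refine h.continuous_integral (c := 4) (by norm_num) (fun a => ?_) (fun y hy a hq => ?_)
      fun y hy a hq => abs_moment_sub_one_le h hC hC' hB hB' ht ht' hy hq
    · have := measurable_logRatio_right h hC hC' hB' a
      fun_prop
    · have := h.continuousAt_logRatio hC hC' hB hB' hy hq
      fun_prop
  convert (h1.mul_const t).add_const 1 using 2 with a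
  field_simp
  ring

/-- The normalization of `exp (t * logRatio)` has mean at most one. -/
lemma lintegral_exp_le_one (h : Dominated ν q p M r S) (hC : IsCompact C) (hC' : C.Nonempty)
    (hB : IsCompact B) (hB' : B.Nonempty) {t : ℝ} (ht : 0 < t) (ht' : t ≤ 1 / 4)
    (a : X) :
    ∫⁻ y, ENNReal.ofReal (Real.exp (t * logRatio p S C B a y - (ratioMoment ν q p S t C B a - 1)))
      ∂(ν.withDensity fun y => (q a y : ℝ≥0∞)) ≤ 1 := by
  set m := ratioMoment ν q p S t C B a with hm
  have hl := measurable_logRatio_right h hC hC' hB' a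
  rw [lintegral_withDensity_eq_lintegral_mul _ (h.measurable_q a).coe_nnreal_ennreal
    (by fun_prop)]
  have h1 : ∀ y, ((fun y => (q a y : ℝ≥0∞)) * fun y =>
      ENNReal.ofReal (Real.exp (t * logRatio p S C B a y - (m - 1)))) y =
      ENNReal.ofReal (Real.exp (1 - m)) *
        ENNReal.ofReal (Real.exp (t * logRatio p S C B a y) * q a y) := by
    intro y
    rw [Pi.mul_apply, ← ENNReal.ofReal_coe_nnreal, ← ENNReal.ofReal_mul (by positivity),
      ← ENNReal.ofReal_mul (by positivity)]
    congr 1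
    rw [show t * logRatio p S C B a y - (m - 1) = (1 - m) + t * logRatio p S C B a y by ring,
      Real.exp_add]
    ring
  simp only [h1]
  have hmq := h.measurable_q a
  rw [lintegral_const_mul _ (by fun_prop), ← ofReal_integral_eq_lintegral_ofReal
    (integrable_moment h hC hC' hB hB' ht ht' a) (ae_of_all _ fun y => by positivity),
    ← ENNReal.ofReal_mul (by positivity)]
  change ENNReal.ofReal (Real.exp (1 - m) * m) ≤ 1
  rw [ENNReal.ofReal_le_one]
  -- Normalizing by `exp (m - 1)` instead of `m` costs only `m ≤ exp (m - 1)`, and leaves an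
  -- exponent that is linear in `m`.
  have h2 := Real.add_one_le_exp (m - 1)
  have h3 : Real.exp (1 - m) * Real.exp (m - 1) = 1 := by rw [← Real.exp_add]; simp
  nlinarith [Real.exp_pos (1 - m)]

/-- If `θ'` fits better than `θ` on average, then so do small neighbourhoods, in the sense that the
mean of `ratioMoment` is less than one. -/
lemma exists_integral_ratioMoment_lt [FirstCountableTopology X] [OpensMeasurableSpace X]
    [SecondCountableTopology X] [CompactSpace X]
    (h : Dominated ν q p M r S) (σ : Measure X) [IsProbabilityMeasure σ] {Cs Bs : ℕ → Set T}
    (hC : ∀ n, IsCompact (Cs n)) (hC' : ∀ n, (Cs n).Nonempty)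
    (hB : ∀ n, IsCompact (Bs n)) (hB' : ∀ n, (Bs n).Nonempty) {θ θ' : T}
    (hCs : Tendsto Cs atTop (𝓝 θ).smallSets) (hBs : Tendsto Bs atTop (𝓝 θ').smallSets)
    (hlt : ∫ a, ∫ y, Real.log (q a y / p θ' a y) * q a y ∂ν ∂σ <
      ∫ a, ∫ y, Real.log (q a y / p θ a y) * q a y ∂ν ∂σ) :
    ∃ n : ℕ, ∫ a, (ratioMoment ν q p S (1 / (n + 4 : ℝ)) (Cs n) (Bs n) a - 1) ∂σ < 0 := by
  -- The exponent tends to zero together with the sets; the shift by 4 keeps it at most `1/4`.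
  have ht : ∀ n : ℕ, 0 < 1 / (n + 4 : ℝ) := fun n => by positivity
  have ht' : ∀ n : ℕ, 1 / (n + 4 : ℝ) ≤ 1 / 4 := fun n =>
    one_div_le_one_div_of_le (by norm_num) (by linarith [n.cast_nonneg (α := ℝ)])
  have ht0 : Tendsto (fun n : ℕ => 1 / (n + 4 : ℝ)) atTop (𝓝 0) :=
    tendsto_const_nhds.div_atTop (tendsto_atTop_add_const_right _ _ tendsto_natCast_atTop_atTop)
  have hlim := h.tendsto_integral_integral σ (c := 4)
    (g := fun n a y => (Real.exp (1 / (n + 4 : ℝ) * logRatio p S (Cs n) (Bs n) a y) - 1) /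
      (1 / (n + 4 : ℝ)))
    (g' := fun a y => Real.log (p θ a y) - Real.log (p θ' a y)) (by norm_num)
    (fun n a => by
      have := measurable_logRatio_right h (hC n) (hC' n) (hB' n) a
      fun_prop)
    (fun n => by
      simp only [← ratioMoment_sub_one_div h (hC n) (hC' n) (hB n) (hB' n) (ht n) (ht' n)]
      have := continuous_ratioMoment h (hC n) (hC' n) (hB n) (hB' n) (ht n) (ht' n)
      exact (by fun_prop : Continuous fun a =>
        (ratioMoment ν q p S (1 / (n + 4 : ℝ)) (Cs n) (Bs n) a - 1) / (1 / (n + 4 : ℝ))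
          ).aestronglyMeasurable)
    (fun n y hy a hq =>
      abs_moment_sub_one_le h (hC n) (hC' n) (hB n) (hB' n) (ht n) (ht' n) hy hq)
    (fun y hy a hq => by
      have h1 := h.tendsto_logRatio hC hC' hB hB' hCs hBs hy hq
      have h2 : Tendsto (fun n : ℕ => logRatio p S (Cs n) (Bs n) a y *
          Real.exp (1 / (n + 4 : ℝ) * logRatio p S (Cs n) (Bs n) a y)) atTop
          (𝓝 (Real.log (p θ a y) - Real.log (p θ' a y))) := by
        have := h1.mul ((Real.continuous_exp.tendsto _).comp (ht0.mul h1))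
        simpa using this
      exact tendsto_of_tendsto_of_tendsto_of_le_of_le h1 h2
        (fun n => (exp_sub_one_div_mem _ (ht n)).1) (fun n => (exp_sub_one_div_mem _ (ht n)).2))
  -- The true density cancels: the limit is the divergence of `θ'` minus that of `θ`.
  have hneg : ∫ a, ∫ y, (Real.log (p θ a y) - Real.log (p θ' a y)) * q a y ∂ν ∂σ < 0 := by
    have hi : ∀ θ, Integrable (fun a => ∫ y, Real.log (q a y / p θ a y) * q a y ∂ν) σ := fun θ =>
      (h.continuous_kl θ).integrable_of_hasCompactSupport
        (HasCompactSupport.of_compactSpace _)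
    have hi' : ∀ θ a, Integrable (fun y => Real.log (q a y / p θ a y) * q a y) ν := fun θ a =>
      h.integrable_mul zero_le_one (by
        have h1 := h.measurable_q a
        have h2 : Measurable fun y => p θ a y := h.measurable_p.comp (by fun_prop :
          Measurable fun y : Y => (θ, a, y))
        exact Real.measurable_log.comp (h1.coe_nnreal_real.div h2.coe_nnreal_real))
        fun y hy hq => (h.abs_log_div_le hy hq θ).trans (h.log_M_le y)
    have h1 : ∫ a, ∫ y, (Real.log (p θ a y) - Real.log (p θ' a y)) * q a y ∂ν ∂σ =
        ∫ a, ∫ y, Real.log (q a y / p θ' a y) * q a y ∂ν ∂σ -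
        ∫ a, ∫ y, Real.log (q a y / p θ a y) * q a y ∂ν ∂σ := by
      rw [← integral_sub (hi θ') (hi θ)]
      congr 1
      funext a
      rw [← integral_sub (hi' θ' a) (hi' θ a)]
      refine integral_congr_ae ?_
      filter_upwards [h.ae_mem] with y hy
      by_cases hq : q a y = 0
      · simp [hq]
      · have hq0 : (q a y : ℝ) ≠ 0 := by exact_mod_cast hq
        rw [Real.log_div hq0 (by exact_mod_cast (h.p_pos hy hq _).ne'),
          Real.log_div hq0 (by exact_mod_cast (h.p_pos hy hq _).ne')]
        ring
    linarith
  obtain ⟨n, hn⟩ := (hlim.eventually_lt_const hneg).exists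
  refine ⟨n, ?_⟩
  simp only [← ratioMoment_sub_one_div h (hC n) (hC' n) (hB n) (hB' n) (ht n) (ht' n)] at hn
  rw [integral_div] at hn
  exact (div_neg_iff.1 hn).resolve_left (fun h => (ht n).not_gt h.2) |>.1

end Dominated

/-! ### Joint continuity of integrals in integrand and measure. -/

lemma continuous_integral_probabilityMeasure {X : Type*} [TopologicalSpace X] [CompactSpace X]
    [MeasurableSpace X] [OpensMeasurableSpace X] :
    Continuous fun z : C(X, ℝ) × ProbabilityMeasure X => ∫ x, z.1 x ∂(z.2 : Measure X) := by
  refine continuous_iff_continuousAt.2 fun ⟨f₀, μ₀⟩ => ?_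
  have hi : ∀ (f : C(X, ℝ)) (μ : ProbabilityMeasure X), Integrable f (μ : Measure X) := fun f μ =>
    (BoundedContinuousFunction.mkOfCompact f).integrable _
  -- Changing the integrand costs at most the sup norm of the difference, whatever the measure;
  -- changing the measure under the fixed `f₀` is weak convergence.
  have h1 : Tendsto (fun z : C(X, ℝ) × ProbabilityMeasure X =>
      ∫ x, (z.1 - f₀) x ∂(z.2 : Measure X)) (𝓝 (f₀, μ₀)) (𝓝 0) := by
    have h0 : Tendsto (fun z : C(X, ℝ) × ProbabilityMeasure X => ‖z.1 - f₀‖) (𝓝 (f₀, μ₀))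
        (𝓝 0) := by
      have : Continuous fun z : C(X, ℝ) × ProbabilityMeasure X => ‖z.1 - f₀‖ := by fun_prop
      simpa using this.tendsto (f₀, μ₀)
    refine squeeze_zero_norm (fun z => ?_) h0
    refine (norm_integral_le_of_norm_le_const (ae_of_all _ (z.1 - f₀).norm_coe_le_norm)).trans ?_
    simp
  have h2 : Tendsto (fun z : C(X, ℝ) × ProbabilityMeasure X => ∫ x, f₀ x ∂(z.2 : Measure X))
      (𝓝 (f₀, μ₀)) (𝓝 (∫ x, f₀ x ∂(μ₀ : Measure X))) := by
    have h3 := ProbabilityMeasure.tendsto_iff_forall_integral_tendsto.1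
      ((continuous_snd (X := C(X, ℝ)) (Y := ProbabilityMeasure X)).tendsto (f₀, μ₀))
    exact h3 (BoundedContinuousFunction.mkOfCompact f₀)
  have h4 := h1.add h2
  rw [zero_add] at h4
  refine h4.congr fun z => ?_
  rw [← integral_add (hi _ _) (hi _ _)]
  simp

/-- Integrals of a jointly continuous function are jointly continuous in the parameter and the
measure. -/
lemma continuous_integral_param {P X : Type*} [TopologicalSpace P] [TopologicalSpace X]
    [CompactSpace X] [MeasurableSpace X] [OpensMeasurableSpace X] {g : P × X → ℝ}
    (hg : Continuous g) :
    Continuous fun z : P × ProbabilityMeasure X => ∫ x, g (z.1, x) ∂(z.2 : Measure X) := by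
  -- Currying turns joint continuity into continuity of a map into `C(X, ℝ)`, whose topology is
  -- uniform because `X` is compact.
  let G : C(P × X, ℝ) := ⟨g, hg⟩
  exact continuous_integral_probabilityMeasure.comp
    (by fun_prop : Continuous fun z : P × ProbabilityMeasure X => (G.curry z.1, z.2))

/-- Supplies measurability for the σ-algebra that kernels use on spaces of measures; it is proved
through kernels, without the weak topology. -/
lemma stronglyMeasurable_integral_param {P X : Type*} [MeasurableSpace P] [MeasurableSpace X]
    {g : P × X → ℝ} (hg : StronglyMeasurable g) :
    StronglyMeasurable fun z : P × ProbabilityMeasure X => ∫ x, g (z.1, x) ∂(z.2 : Measure X) := by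
  let κ : Kernel (P × ProbabilityMeasure X) X :=
    ⟨fun z => (z.2 : Measure X), measurable_subtype_coe.comp measurable_snd⟩
  have : IsMarkovKernel κ := ⟨fun z => inferInstanceAs (IsProbabilityMeasure (z.2 : Measure X))⟩
  exact StronglyMeasurable.integral_kernel_prod_right' (κ := κ)
    (f := fun w : (P × ProbabilityMeasure X) × X => g (w.1.1, w.2))
    (hg.comp_measurable (by fun_prop))

lemma continuous_assemble {I : Type*} [DecidableEq I] {A : I → Type*}
    [∀ i, TopologicalSpace (A i)] (i : I) :
    Continuous fun z : A i × Others A i => assemble i z.1 z.2 := by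
  refine continuous_pi fun j => ?_
  by_cases hj : j = i
  · subst hj
    simpa [assemble, Equiv.piSplitAt] using continuous_fst
  · have : Continuous fun z : A i × Others A i => z.2 ⟨j, hj⟩ := by fun_prop
    simpa [assemble, Equiv.piSplitAt, hj] using this

/-! ### Expected payoffs and the best-response correspondence. -/

section Game

variable {I : Type*} {A Y Θ : I → Type*} [∀ i, MeasurableSpace (A i)]
  [∀ i, MeasurableSpace (Y i)] [∀ i, MeasurableSpace (Θ i)] [∀ i, TopologicalSpace (A i)]
  [∀ i, TopologicalSpace (Θ i)] {G : Game A Y Θ}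

/-- The standing assumptions provide a common full-measure set of regular consequences. -/
lemma Game.Regular.exists_dominated [Countable I] [∀ i, SecondCountableTopology (A i)]
    [∀ i, SecondCountableTopology (Θ i)] [∀ i, Nonempty (Θ i)] (hG : G.Regular) (i : I) :
    ∃ (M r h : Y i → ℝ≥0) (S : Set (Y i)), Dominated (G.ν i) (G.q i) (G.qm i) M r S ∧
      Measurable h ∧ (∀ x, ∀ᵐ y ∂G.ν i, |G.payoff i x y| ≤ h y) ∧
      ∫⁻ y, (h y : ℝ≥0∞) * M y * r y ∂G.ν i < ∞ := by
  obtain ⟨M, r, h, hM, hr, hh, hM1, hb, hMr, hp, hhMr⟩ := hG.envelopes i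
  -- The null sets in the envelope bounds depend on `(θ, a)`. A countable dense set of pairs
  -- suffices, because the bounds are closed conditions once the densities are continuous.
  obtain ⟨D, hDc, hDd⟩ := TopologicalSpace.exists_countable_dense (Θ i × Profile A)
  have hae : ∀ᵐ y ∂G.ν i, (Continuous fun a => G.q i a y) ∧
      (Continuous fun p : Θ i × Profile A => G.qm i p.1 p.2 y) ∧
      ∀ z ∈ D, G.qm i z.1 z.2 y ≤ G.q i z.2 y * M y ∧ G.q i z.2 y ≤ G.qm i z.1 z.2 y * M y ∧
        G.q i z.2 y ≤ r y := by
    have h1 := (ae_ball_iff hDc).2 fun z (_ : z ∈ D) => hb z.1 z.2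
    filter_upwards [hG.continuous_q i, hG.continuous_qm i, h1] with y hy1 hy2 hy3
    refine ⟨hy1, hy2, fun z hz => ⟨?_, (hy3 z hz).2⟩⟩
    have h2 := (hy3 z hz).1
    rwa [← div_eq_mul_inv, div_le_iff₀ (lt_of_lt_of_le one_pos (hM1 y))] at h2
  obtain ⟨N, hN, hNm, hN0⟩ := exists_measurable_superset_of_null hae
  have hS : ∀ y ∈ Nᶜ, (Continuous fun a => G.q i a y) ∧
      (Continuous fun p : Θ i × Profile A => G.qm i p.1 p.2 y) ∧
      ∀ z : Θ i × Profile A, G.qm i z.1 z.2 y ≤ G.q i z.2 y * M y ∧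
        G.q i z.2 y ≤ G.qm i z.1 z.2 y * M y ∧ G.q i z.2 y ≤ r y := by
    intro y hy
    obtain ⟨h1, h2, h3⟩ := not_not.1 fun h => hy (hN h)
    refine ⟨h1, h2, fun z => ?_⟩
    have h1' : Continuous fun z : Θ i × Profile A => G.q i z.2 y := h1.comp continuous_snd
    have h1'' : IsClosed {z : Θ i × Profile A | G.q i z.2 y ≤ r y} :=
      isClosed_le h1' continuous_const
    have hcl : IsClosed {z : Θ i × Profile A | G.qm i z.1 z.2 y ≤ G.q i z.2 y * M y ∧
        G.q i z.2 y ≤ G.qm i z.1 z.2 y * M y ∧ G.q i z.2 y ≤ r y} :=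
      (isClosed_le h2 (h1'.mul continuous_const)).inter
        ((isClosed_le h1' (h2.mul continuous_const)).inter h1'')
    exact hcl.closure_subset_iff.2 h3 (hDd z)
  refine ⟨M, r, h, Nᶜ, ?_, hh, hp, hhMr⟩
  exact
    { measurableSet := hNm.compl
      null_compl := by rwa [compl_compl]
      measurable_q := hG.measurable_q i
      measurable_p := G.measurable_qm i
      measurable_M := hM
      measurable_r := hr
      one_le := hM1
      continuous_q := fun y hy => (hS y hy).1
      continuous_p := fun y hy => (hS y hy).2.1
      le_mul_q := fun y hy θ a => ((hS y hy).2.2 (θ, a)).1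
      q_le := fun y hy θ a => ((hS y hy).2.2 (θ, a)).2.1
      q_le_r := fun y hy a => ((hS y hy).2.2 (Classical.arbitrary _, a)).2.2
      lintegral_lt := hMr
      lintegral_q := fun a => by
        have h1 : (G.Q i a : Measure (Y i)) Set.univ = 1 := measure_univ
        rw [hG.density_Q, withDensity_apply _ MeasurableSet.univ, Measure.restrict_univ] at h1
        exact h1 }

/-- Expected payoff of an action given a parameter and the others' actions. -/
lemma Game.Regular.continuous_payoff_integral [DecidableEq I] [Countable I]
    [∀ i, SecondCountableTopology (A i)] [∀ i, SecondCountableTopology (Θ i)]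
    [∀ i, Nonempty (Θ i)] (hG : G.Regular) (i : I) :
    Continuous fun z : (A i × Θ i) × Others A i =>
      ∫ y, G.payoff i z.1.1 y ∂(G.Qm i z.1.2 (assemble i z.1.1 z.2) : Measure (Y i)) := by
  obtain ⟨M, r, h, S, hD, hh, hp, hi⟩ := hG.exists_dominated i
  have hqm : ∀ θ a, Measurable (G.qm i θ a) := fun θ a =>
    (G.measurable_qm i).comp (by fun_prop : Measurable fun y : Y i => (θ, a, y))
  have h1 : ∀ z : (A i × Θ i) × Others A i,
      ∫ y, G.payoff i z.1.1 y ∂(G.Qm i z.1.2 (assemble i z.1.1 z.2) : Measure (Y i)) =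
      ∫ y, (G.qm i z.1.2 (assemble i z.1.1 z.2) y : ℝ) * G.payoff i z.1.1 y ∂G.ν i := fun z => by
    rw [hG.density_Qm, integral_withDensity_eq_integral_smul (hqm _ _)]
    rfl
  simp only [h1]
  have hM := hD.measurable_M
  have hr := hD.measurable_r
  refine continuous_of_dominated (bound := fun y => (h y * M y * r y : ℝ)) (fun z => ?_)
    (fun z => ?_) ?_ ?_
  · exact ((hqm _ _).coe_nnreal_real.aemeasurable.mul
      (hG.aemeasurable_payoff i _)).aestronglyMeasurable
  · filter_upwards [hD.ae_mem, hp z.1.1] with y hy hpy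
    set a := assemble i z.1.1 z.2
    rw [norm_mul, Real.norm_of_nonneg (NNReal.coe_nonneg _), Real.norm_eq_abs]
    have h2 : (G.qm i z.1.2 a y : ℝ) ≤ r y * M y := by
      exact_mod_cast (hD.le_mul_q y hy z.1.2 a).trans
        (mul_le_mul_of_nonneg_right (hD.q_le_r y hy a) zero_le)
    calc _ ≤ (r y * M y : ℝ) * h y := mul_le_mul h2 hpy (abs_nonneg _) (by positivity)
      _ = _ := by ring
  · have h3 : Integrable (fun y => ((h y * M y * r y : ℝ≥0) : ℝ)) (G.ν i) := by
      refine ⟨by fun_prop, ?_⟩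
      rw [HasFiniteIntegral]
      simpa using hi
    simpa using h3
  · filter_upwards [hD.ae_mem, hG.continuous_payoff i] with y hy hpy
    have h4 : Continuous fun z : (A i × Θ i) × Others A i => assemble i z.1.1 z.2 :=
      (continuous_assemble i).comp (by fun_prop :
        Continuous fun z : (A i × Θ i) × Others A i => (z.1.1, z.2))
    have h5 : Continuous fun z : (A i × Θ i) × Others A i => (z.1.2, assemble i z.1.1 z.2) := by
      fun_prop
    exact (NNReal.continuous_coe.comp ((hD.continuous_p y hy).comp h5)).mul
      (hpy.comp (by fun_prop : Continuous fun z : (A i × Θ i) × Others A i => z.1.1))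

section

variable [DecidableEq I] [Countable I] [∀ i, SecondCountableTopology (A i)]
  [∀ i, SecondCountableTopology (Θ i)] [∀ i, Nonempty (Θ i)]
  [∀ i, BorelSpace (A i)] [∀ i, BorelSpace (Θ i)]

lemma Game.Regular.measurable_objective (hG : G.Regular) (i : I) :
    Measurable fun z : (A i × ProbabilityMeasure (Others A i)) × ProbabilityMeasure (Θ i) =>
      ∫ θ, G.utility i z.1.1 z.1.2 θ ∂(z.2 : Measure (Θ i)) := by
  have h1 := stronglyMeasurable_integral_param
    (hG.continuous_payoff_integral i).stronglyMeasurable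
  have h2 : StronglyMeasurable fun w : (A i × ProbabilityMeasure (Others A i)) × Θ i =>
      G.utility i w.1.1 w.1.2 w.2 :=
    h1.comp_measurable (by fun_prop :
      Measurable fun w : (A i × ProbabilityMeasure (Others A i)) × Θ i => ((w.1.1, w.2), w.1.2))
  exact (stronglyMeasurable_integral_param h2).measurable

variable [∀ i, CompactSpace (A i)] [∀ i, CompactSpace (Θ i)]

/-- The objective of player `i` is jointly continuous in action, forecast and belief. -/
lemma Game.Regular.continuous_objective (hG : G.Regular) (i : I) :
    Continuous fun z : (A i × ProbabilityMeasure (Others A i)) × ProbabilityMeasure (Θ i) =>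
      ∫ θ, G.utility i z.1.1 z.1.2 θ ∂(z.2 : Measure (Θ i)) := by
  have h1 := continuous_integral_param (hG.continuous_payoff_integral i)
  have h2 : Continuous fun w : (A i × ProbabilityMeasure (Others A i)) × Θ i =>
      G.utility i w.1.1 w.1.2 w.2 :=
    h1.comp (by fun_prop : Continuous fun w : (A i × ProbabilityMeasure (Others A i)) × Θ i =>
      ((w.1.1, w.2), w.1.2))
  exact continuous_integral_param h2

/-- The optimal action correspondence has a closed graph. -/
lemma Game.Regular.bestResponse_of_tendsto (hG : G.Regular) (i : I) {ι : Type*} {l : Filter ι}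
    [l.NeBot] {x : ι → A i} {μ : ι → ProbabilityMeasure (Θ i)}
    {β : ι → ProbabilityMeasure (Others A i)} {x₀ : A i} {μ₀ : ProbabilityMeasure (Θ i)}
    {β₀ : ProbabilityMeasure (Others A i)} (hx : Tendsto x l (𝓝 x₀)) (hμ : Tendsto μ l (𝓝 μ₀))
    (hβ : Tendsto β l (𝓝 β₀)) (h : ∀ k, x k ∈ G.bestResponse i (μ k) (β k)) :
    x₀ ∈ G.bestResponse i μ₀ β₀ := by
  intro x'
  have hc := hG.continuous_objective i
  exact le_of_tendsto_of_tendsto'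
    ((hc.tendsto ((x', β₀), μ₀)).comp ((tendsto_const_nhds.prodMk_nhds hβ).prodMk_nhds hμ))
    ((hc.tendsto ((x₀, β₀), μ₀)).comp ((hx.prodMk_nhds hβ).prodMk_nhds hμ)) fun k => h k x'

lemma Game.Regular.isClosed_bestResponse (hG : G.Regular) (i : I)
    (μ : ProbabilityMeasure (Θ i)) (β : ProbabilityMeasure (Others A i)) :
    IsClosed (G.bestResponse i μ β) := by
  have hc : Continuous fun x => ∫ θ, G.utility i x β θ ∂(μ : Measure (Θ i)) :=
    (hG.continuous_objective i).comp (by fun_prop : Continuous fun x : A i => ((x, β), μ))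
  simp only [Game.bestResponse, Set.ofPred_forall]
  exact isClosed_iInter fun x' => isClosed_le continuous_const hc

/-- By continuity of the objective in the action it suffices to beat a countable dense set of
deviations. -/
lemma Game.Regular.measurableSet_bestResponse (hG : G.Regular) (i : I) :
    MeasurableSet {p : (ProbabilityMeasure (Θ i) × ProbabilityMeasure (Others A i)) × A i |
      p.2 ∈ G.bestResponse i p.1.1 p.1.2} := by
  obtain ⟨D, hDc, hDd⟩ := TopologicalSpace.exists_countable_dense (A i)
  have h1 : {p : (ProbabilityMeasure (Θ i) × ProbabilityMeasure (Others A i)) × A i |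
      p.2 ∈ G.bestResponse i p.1.1 p.1.2} = ⋂ x' ∈ D,
      {p | ∫ θ, G.utility i x' p.1.2 θ ∂(p.1.1 : Measure (Θ i)) ≤
        ∫ θ, G.utility i p.2 p.1.2 θ ∂(p.1.1 : Measure (Θ i))} := by
    ext ⟨⟨μ, β⟩, x⟩
    simp only [Set.mem_iInter]
    refine ⟨fun h x' _ => h x', fun h x' => ?_⟩
    have hc : Continuous fun x => ∫ θ, G.utility i x β θ ∂(μ : Measure (Θ i)) :=
      (hG.continuous_objective i).comp (by fun_prop : Continuous fun x : A i => ((x, β), μ))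
    exact (isClosed_le hc continuous_const).closure_subset_iff.2 h (hDd x')
  rw [h1]
  have hm := hG.measurable_objective i
  refine MeasurableSet.biInter hDc fun x' _ => measurableSet_le ?_ ?_
  · exact hm.comp (by fun_prop : Measurable
      fun p : (ProbabilityMeasure (Θ i) × ProbabilityMeasure (Others A i)) × A i =>
        ((x', p.1.2), p.1.1))
  · exact hm.comp (by fun_prop : Measurable
      fun p : (ProbabilityMeasure (Θ i) × ProbabilityMeasure (Others A i)) × A i =>
        ((p.2, p.1.2), p.1.1))

/-- Almost surely, every player always best responds to her belief and forecast. -/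
lemma Dynamics.Bayesian.ae_mem_bestResponse (hG : G.Regular) {D : Dynamics G} (hB : D.Bayesian) :
    ∀ᵐ ω ∂D.law, ∀ i n, (ω n).1 i ∈ G.bestResponse i
      (G.posterior i (D.prior i) n fun s => ω s) (D.forecast i n fun s => (ω s).1) := by
  rw [ae_all_iff]
  intro i
  rw [ae_all_iff]
  intro n
  refine D.ae_choice i n (P := fun (b : ProbabilityMeasure (Θ i) ×
    ProbabilityMeasure (Others A i)) (x : A i) => x ∈ G.bestResponse i b.1 b.2)
    (hG.measurableSet_bestResponse i) fun b => ?_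
  -- `choice` has total mass one as a marginal of the joint law, evaluated at any beliefs and
  -- forecasts whose `i`-th entry is `b`.
  have h1 : IsProbabilityMeasure (D.choice i n b) := by
    have := D.jointChoice_markov n
    have h2 := D.jointChoice_marginal n
      (Function.update (fun j => (D.prior j, D.forecast j 0 Fin.elim0)) i b) i
    rw [Function.update_self] at h2
    rw [← h2]
    exact Measure.isProbabilityMeasure_map (measurable_pi_apply i).aemeasurable
  exact (prob_compl_eq_zero_iff (hG.isClosed_bestResponse i b.1 b.2).measurableSet).2
    (hB.optimal i n b.1 b.2)

end

end Game

/-! ### Posterior odds along a path. -/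

lemma integral_empirical {X : Type*} [MeasurableSpace X] (a : ℕ → X) (n : ℕ) {f : X → ℝ}
    (hf : StronglyMeasurable f) :
    ∫ x, f x ∂(empirical a n : Measure X) =
      ((n + 1 : ℕ) : ℝ)⁻¹ * ∑ s ∈ Finset.range (n + 1), f (a s) := by
  have h1 : (empirical a n : Measure X) =
      ((n + 1 : ℕ) : ℝ≥0∞)⁻¹ • ∑ s ∈ Finset.range (n + 1), Measure.dirac (a s) := by
    rw [empirical, ProbabilityMeasure.coe_mk]
  rw [h1, integral_smul_measure, integral_finsetSum_measure]
  · simp only [integral_dirac' _ _ hf, smul_eq_mul, ENNReal.toReal_inv, ENNReal.toReal_natCast]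
  · intro s _
    exact integrable_dirac' hf (by simp)

section Game

variable {I : Type*} {A Y Θ : I → Type*} [∀ i, MeasurableSpace (A i)]
  [∀ i, MeasurableSpace (Y i)] [∀ i, MeasurableSpace (Θ i)] [∀ i, TopologicalSpace (A i)]
  [∀ i, TopologicalSpace (Θ i)] {G : Game A Y Θ} {i : I} {M r : Y i → ℝ≥0} {S : Set (Y i)}
  {C B : Set (Θ i)}

/-- Excludes the default branch of Bayes' rule at every regular consequence of positive true
density. -/
lemma Game.evidence_ne (hD : Dominated (G.ν i) (G.q i) (G.qm i) M r S)
    (μ : ProbabilityMeasure (Θ i)) {a : Profile A} {y : Y i} (hy : y ∈ S) (hq : G.q i a y ≠ 0) :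
    ¬ (G.evidence i μ a y = 0 ∨ G.evidence i μ a y = ∞) := by
  have hm : Measurable fun θ => (G.qm i θ a y : ℝ≥0∞) := ((G.measurable_qm i).comp
    (by fun_prop : Measurable fun θ : Θ i => (θ, a, y))).coe_nnreal_ennreal
  rw [not_or]
  constructor
  · unfold Game.evidence
    rw [lintegral_eq_zero_iff hm]
    intro h0
    obtain ⟨θ, hθ⟩ := h0.exists
    have := (hD.p_pos hy hq θ).ne'
    simp_all
  · refine ne_of_lt (lt_of_le_of_lt (lintegral_mono (g := fun _ => ((G.q i a y * M y : ℝ≥0) : ℝ≥0∞))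
      fun θ => ENNReal.coe_le_coe.2 (hD.le_mul_q y hy θ a)) ?_)
    simp [ENNReal.mul_lt_top]

/-- The posterior odds of `C` against `B` grow at most by the largest likelihood ratio. -/
lemma Game.bayes_mul_le (hD : Dominated (G.ν i) (G.q i) (G.qm i) M r S)
    (μ : ProbabilityMeasure (Θ i)) {a : Profile A} {y : Y i} (hy : y ∈ S) (hq : G.q i a y ≠ 0)
    (hC : IsCompact C) (hC' : C.Nonempty) (hCm : MeasurableSet C)
    (hB : IsCompact B) (hB' : B.Nonempty) (hBm : MeasurableSet B) {R b c : ℝ≥0∞}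
    (h : (μ : Measure (Θ i)) C * b ≤ R * ((μ : Measure (Θ i)) B * c)) :
    (G.bayes i μ a y : Measure (Θ i)) C * b ≤
      R * ENNReal.ofReal (Real.exp (logRatio (G.qm i) S C B a y)) *
        ((G.bayes i μ a y : Measure (Θ i)) B * c) := by
  obtain ⟨u, v, hu, hv, huv⟩ := hD.exists_bounds hC hC' hB hB' hy hq
  set e := ENNReal.ofReal (Real.exp (logRatio (G.qm i) S C B a y))
  have h1 : ∀ s, MeasurableSet s → (G.bayes i μ a y : Measure (Θ i)) s =
      (G.evidence i μ a y)⁻¹ * ∫⁻ θ in s, (G.qm i θ a y : ℝ≥0∞) ∂(μ : Measure (Θ i)) := by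
    intro s hs
    change G.bayesMeasure i μ a y s = _
    rw [Game.bayesMeasure, if_neg (G.evidence_ne hD μ hy hq), Measure.smul_apply,
      withDensity_apply _ hs, smul_eq_mul]
  have h2 : ∫⁻ θ in C, (G.qm i θ a y : ℝ≥0∞) ∂(μ : Measure (Θ i)) ≤
      u * (μ : Measure (Θ i)) C := by
    refine (setLIntegral_mono' hCm fun θ hθ => ENNReal.coe_le_coe.2 (hu θ hθ)).trans ?_
    rw [setLIntegral_const]
  have h3 : v * (μ : Measure (Θ i)) B ≤
      ∫⁻ θ in B, (G.qm i θ a y : ℝ≥0∞) ∂(μ : Measure (Θ i)) := by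
    refine le_trans ?_ (setLIntegral_mono' hBm fun θ hθ => ENNReal.coe_le_coe.2 (hv θ hθ))
    rw [setLIntegral_const]
  rw [h1 C hCm, h1 B hBm]
  set E := (G.evidence i μ a y)⁻¹
  calc E * (∫⁻ θ in C, (G.qm i θ a y : ℝ≥0∞) ∂(μ : Measure (Θ i))) * b
      ≤ E * (u * (μ : Measure (Θ i)) C) * b := by gcongr
    _ = E * u * ((μ : Measure (Θ i)) C * b) := by ring
    _ ≤ E * u * (R * ((μ : Measure (Θ i)) B * c)) := by gcongr
    _ = R * e * (E * (v * (μ : Measure (Θ i)) B) * c) := by rw [huv]; ring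
    _ ≤ _ := by gcongr

/-- Posterior odds are bounded by prior odds times the product of the largest likelihood ratios. -/
lemma Game.posterior_mul_le (hD : Dominated (G.ν i) (G.q i) (G.qm i) M r S)
    (prior : ProbabilityMeasure (Θ i)) {ω : ℕ → Outcome A Y}
    (hω : ∀ n, (ω n).2 i ∈ S ∧ G.q i (ω n).1 ((ω n).2 i) ≠ 0)
    (hC : IsCompact C) (hC' : C.Nonempty) (hCm : MeasurableSet C)
    (hB : IsCompact B) (hB' : B.Nonempty) (hBm : MeasurableSet B) (n : ℕ) :
    (G.posterior i prior n (fun s => ω s) : Measure (Θ i)) C * (prior : Measure (Θ i)) B ≤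
      ENNReal.ofReal (Real.exp (∑ s ∈ Finset.range n,
        logRatio (G.qm i) S C B (ω s).1 ((ω s).2 i))) *
      ((G.posterior i prior n (fun s => ω s) : Measure (Θ i)) B * (prior : Measure (Θ i)) C) := by
  induction n with
  | zero => simp [Game.posterior, mul_comm]
  | succ n ih =>
    rw [Finset.sum_range_succ, Real.exp_add, ENNReal.ofReal_mul (Real.exp_pos _).le]
    exact G.bayes_mul_le hD _ (hω n).1 (hω n).2 hC hC' hCm hB hB' hBm ih

variable [Countable I] [∀ i, SecondCountableTopology (A i)] [∀ i, BorelSpace (A i)]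
  [∀ i, CompactSpace (A i)] [TopologicalSpace.PseudoMetrizableSpace (Θ i)]
  [SecondCountableTopology (Θ i)]

/-- Beliefs vanish on `C` if, on average along the empirical distributions, `C` fits worse
than `B`. -/
lemma Game.tendsto_posterior_zero (hD : Dominated (G.ν i) (G.q i) (G.qm i) M r S)
    (prior : ProbabilityMeasure (Θ i)) {ω : ℕ → Outcome A Y}
    (hω : ∀ n, (ω n).2 i ∈ S ∧ G.q i (ω n).1 ((ω n).2 i) ≠ 0)
    (hC : IsCompact C) (hC' : C.Nonempty) (hCm : MeasurableSet C)
    (hB : IsCompact B) (hB' : B.Nonempty) (hBm : MeasurableSet B)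
    (hpos : (prior : Measure (Θ i)) B ≠ 0) {t : ℝ} (ht : 0 < t) (ht' : t ≤ 1 / 4)
    (hev : ∀ k : ℕ, ∀ᶠ n : ℕ in atTop, ∏ s ∈ Finset.range n,
      ENNReal.ofReal (Real.exp (t * logRatio (G.qm i) S C B (ω s).1 ((ω s).2 i) -
        (ratioMoment (G.ν i) (G.q i) (G.qm i) S t C B (ω s).1 - 1))) ≤
      ENNReal.ofReal (Real.exp (1 / (k + 1 : ℝ) * n)))
    {τ : ℕ → ℕ} (hτ : StrictMono τ) {σ : ProbabilityMeasure (Profile A)}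
    (hσ : Tendsto (fun k => empirical (fun n => (ω n).1) (τ k)) atTop (𝓝 σ))
    (hlt : ∫ a, (ratioMoment (G.ν i) (G.q i) (G.qm i) S t C B a - 1) ∂(σ : Measure (Profile A))
      < 0) :
    Tendsto (fun k => (G.posterior i prior (τ k) (fun s => ω s) : Measure (Θ i)) C) atTop
      (𝓝 0) := by
  set f : Profile A → ℝ := fun a => ratioMoment (G.ν i) (G.q i) (G.qm i) S t C B a - 1 with hf
  set d : ℕ → ℝ := fun s => logRatio (G.qm i) S C B (ω s).1 ((ω s).2 i) with hd
  have hfc : Continuous f :=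
    (hD.continuous_ratioMoment hC hC' hB hB' ht ht').sub continuous_const
  set F := BoundedContinuousFunction.mkOfCompact ⟨f, hfc⟩
  set c := ∫ a, f a ∂(σ : Measure (Profile A)) with hc
  -- The subexponential growth rate is chosen smaller than the drift `-c`.
  obtain ⟨k₀, hk₀⟩ := exists_nat_one_div_lt (show 0 < -c by linarith)
  have hτ' : Tendsto (fun k => ((τ k + 1 : ℕ) : ℝ)) atTop atTop :=
    tendsto_natCast_atTop_atTop.comp ((tendsto_add_atTop_nat 1).comp hτ.tendsto_atTop)
  have havg : Tendsto (fun k => ((τ k + 1 : ℕ) : ℝ)⁻¹ *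
      ∑ s ∈ Finset.range (τ k + 1), f (ω s).1) atTop (𝓝 c) := by
    have h1 := ProbabilityMeasure.tendsto_iff_forall_integral_tendsto.1 hσ F
    refine h1.congr fun k => ?_
    exact integral_empirical _ _ hfc.stronglyMeasurable
  -- The belief at time `τ k` rests on `τ k` outcomes while the empirical distribution counts `τ k +
  -- 1` actions; `‖F‖` pays for the extra term.
  have hbot : Tendsto (fun k => t⁻¹ * (((τ k + 1 : ℕ) : ℝ) * (1 / (k₀ + 1 : ℝ) +
      ((τ k + 1 : ℕ) : ℝ)⁻¹ * ∑ s ∈ Finset.range (τ k + 1), f (ω s).1) + ‖F‖)) atTop atBot := by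
    refine Tendsto.const_mul_atBot (inv_pos.2 ht) (tendsto_atBot_add_const_right _ _ ?_)
    exact hτ'.atTop_mul_neg (show 1 / (k₀ + 1 : ℝ) + c < 0 by linarith)
      (tendsto_const_nhds.add havg)
  have hle : ∀ᶠ k in atTop, ∑ s ∈ Finset.range (τ k), d s ≤
      t⁻¹ * (((τ k + 1 : ℕ) : ℝ) * (1 / (k₀ + 1 : ℝ) +
      ((τ k + 1 : ℕ) : ℝ)⁻¹ * ∑ s ∈ Finset.range (τ k + 1), f (ω s).1) + ‖F‖) := by
    filter_upwards [hτ.tendsto_atTop.eventually (hev k₀)] with k hk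
    rw [← ENNReal.ofReal_prod_of_nonneg (fun s _ => (Real.exp_pos _).le), ← Real.exp_sum,
      ENNReal.ofReal_le_ofReal_iff (Real.exp_pos _).le, Real.exp_le_exp, Finset.sum_sub_distrib,
      ← Finset.mul_sum] at hk
    have h1 : -f (ω (τ k)).1 ≤ ‖F‖ :=
      (neg_le_abs _).trans (F.norm_coe_le_norm (ω (τ k)).1)
    have h2 : ((τ k + 1 : ℕ) : ℝ) * (1 / (k₀ + 1 : ℝ) +
        ((τ k + 1 : ℕ) : ℝ)⁻¹ * ∑ s ∈ Finset.range (τ k + 1), f (ω s).1) =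
        1 / (k₀ + 1 : ℝ) * (τ k) + 1 / (k₀ + 1 : ℝ) +
        (∑ s ∈ Finset.range (τ k), f (ω s).1 + f (ω (τ k)).1) := by
      rw [mul_add, ← mul_assoc, mul_inv_cancel₀ (by positivity), one_mul, Finset.sum_range_succ]
      push_cast
      ring
    have h3 : (0 : ℝ) ≤ 1 / (k₀ + 1 : ℝ) := by positivity
    rw [h2, le_inv_mul_iff₀ ht]
    linarith
  have hsum : Tendsto (fun k => ∑ s ∈ Finset.range (τ k), d s) atTop atBot :=
    tendsto_atBot_mono' _ hle hbot
  have hexp : Tendsto (fun k => ENNReal.ofReal (Real.exp (∑ s ∈ Finset.range (τ k), d s)) /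
      (prior : Measure (Θ i)) B) atTop (𝓝 0) := by
    have h1 := ENNReal.tendsto_ofReal (Real.tendsto_exp_atBot.comp hsum)
    have h2 := ENNReal.Tendsto.div_const h1 (b := (prior : Measure (Θ i)) B) (Or.inr hpos)
    simpa using h2
  refine tendsto_of_tendsto_of_tendsto_of_le_of_le tendsto_const_nhds hexp (fun _ => zero_le)
    fun k => ?_
  dsimp only
  rw [ENNReal.le_div_iff_mul_le (Or.inl hpos) (Or.inl (measure_ne_top _ _))]
  refine (G.posterior_mul_le hD prior hω hC hC' hCm hB hB' hBm (τ k)).trans ?_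
  exact mul_le_of_le_one_right' (mul_le_one' prob_le_one prob_le_one)

end Game

/-! ### Almost sure concentration of limit beliefs on best-fitting parameters. -/

section

variable {I : Type*} {A Y Θ : I → Type*} [∀ i, MeasurableSpace (A i)]
  [∀ i, MeasurableSpace (Y i)] [∀ i, MeasurableSpace (Θ i)] [∀ i, TopologicalSpace (A i)]
  [∀ i, PseudoMetricSpace (Θ i)] {G : Game A Y Θ}
  [Countable I] [DecidableEq I] [∀ i, SecondCountableTopology (A i)] [∀ i, BorelSpace (A i)]
  [∀ i, CompactSpace (A i)] [∀ i, BorelSpace (Θ i)] [∀ i, CompactSpace (Θ i)]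
  [∀ i, SecondCountableTopology (Θ i)] [∀ i, Nonempty (Θ i)]

/-- A countable family of closed balls that contains arbitrarily small neighbourhoods of every
point. -/
noncomputable def smallBall (T : Type*) [PseudoMetricSpace T] [TopologicalSpace.SeparableSpace T]
    [Nonempty T] (j n : ℕ) : Set T :=
  Metric.closedBall (TopologicalSpace.denseSeq T j) (1 / (n + 1 : ℝ))

lemma smallBall_nonempty (T : Type*) [PseudoMetricSpace T] [TopologicalSpace.SeparableSpace T]
    [Nonempty T] (j n : ℕ) : (smallBall T j n).Nonempty :=
  ⟨_, Metric.mem_closedBall_self (by positivity)⟩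

lemma isClosed_smallBall (T : Type*) [PseudoMetricSpace T] [TopologicalSpace.SeparableSpace T]
    [Nonempty T] (j n : ℕ) : IsClosed (smallBall T j n) :=
  Metric.isClosed_closedBall

lemma exists_smallBall {T : Type*} [PseudoMetricSpace T] [TopologicalSpace.SeparableSpace T]
    [Nonempty T] (θ : T) : ∃ j : ℕ → ℕ, (∀ n, smallBall T (j n) n ∈ 𝓝 θ) ∧
      Tendsto (fun n => smallBall T (j n) n) atTop (𝓝 θ).smallSets := by
  have h1 : ∀ n : ℕ, ∃ j, dist θ (TopologicalSpace.denseSeq T j) < 1 / (n + 1 : ℝ) := fun n =>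
    (TopologicalSpace.denseRange_denseSeq T).exists_dist_lt θ (by positivity)
  choose j hj using h1
  refine ⟨j, fun n => ?_, tendsto_smallSets_iff.2 fun U hU => ?_⟩
  · exact mem_of_superset (Metric.isOpen_ball.mem_nhds (Metric.mem_ball.2 (hj n)))
      Metric.ball_subset_closedBall
  · obtain ⟨ε, hε, hεU⟩ := Metric.mem_nhds_iff.1 hU
    have h2 : Tendsto (fun n : ℕ => 1 / (n + 1 : ℝ)) atTop (𝓝 0) :=
      tendsto_one_div_add_atTop_nhds_zero_nat
    filter_upwards [h2.eventually_lt_const (half_pos hε)] with n hn θ' hθ'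
    refine hεU (Metric.mem_ball.2 ?_)
    have h3 := hj n
    rw [dist_comm] at h3
    have h4 := Metric.mem_closedBall.1 hθ'
    linarith [dist_triangle θ' (TopologicalSpace.denseSeq T (j n)) θ]

/-- Almost surely, limits of beliefs are concentrated on the parameters that fit best the limit of
the empirical distributions. -/
lemma Dynamics.Bayesian.ae_bestFit_of_tendsto (hG : G.Regular) {D : Dynamics G}
    (hB : D.Bayesian) (i : I) :
    ∀ᵐ ω ∂D.law, ∀ (τ : ℕ → ℕ) (σ : ProbabilityMeasure (Profile A))
      (μ : ProbabilityMeasure (Θ i)), StrictMono τ →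
      Tendsto (fun k => empirical (fun n => (ω n).1) (τ k)) atTop (𝓝 σ) →
      Tendsto (fun k => G.posterior i (D.prior i) (τ k) fun s => ω s) atTop (𝓝 μ) →
      ∀ᵐ θ ∂(μ : Measure (Θ i)), θ ∈ G.bestFit i σ := by
  obtain ⟨M, r, -, S, hD, -⟩ := hG.exists_dominated i
  have hcpt : ∀ j n, IsCompact (smallBall (Θ i) j n) := fun j n =>
    (isClosed_smallBall _ j n).isCompact
  have hne := smallBall_nonempty (Θ i)
  have ht : ∀ n : ℕ, 0 < 1 / (n + 4 : ℝ) := fun n => by positivity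
  have ht' : ∀ n : ℕ, 1 / (n + 4 : ℝ) ≤ 1 / 4 := fun n =>
    one_div_le_one_div_of_le (by norm_num) (by linarith [n.cast_nonneg (α := ℝ)])
  have hgood : ∀ᵐ ω ∂D.law, ∀ n, (ω n).2 i ∈ S ∧ G.q i (ω n).1 ((ω n).2 i) ≠ 0 := by
    -- On `S` the true density and any likelihood vanish together. Positivity is stated through `θ₀`
    -- because only the likelihoods are assumed jointly measurable in action and consequence.
    let θ₀ : Θ i := Classical.arbitrary _
    have h1 := D.ae_consequence i (P := fun a y => y ∈ S ∧ G.qm i θ₀ a y ≠ 0) ?_ ?_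
    · filter_upwards [h1] with ω hω n
      exact ⟨(hω n).1, fun h0 => (hω n).2 (hD.p_eq_zero (hω n).1 h0 _)⟩
    · have hm : Measurable fun z : Profile A × Y i => G.qm i θ₀ z.1 z.2 :=
        (G.measurable_qm i).comp (by fun_prop : Measurable fun z : Profile A × Y i =>
          (θ₀, z.1, z.2))
      exact (measurable_snd hD.measurableSet).inter (hm (measurableSet_singleton 0).compl)
    · intro a
      rw [hG.density_Q, ae_withDensity_iff (hG.measurable_q i a).coe_nnreal_ennreal]
      filter_upwards [hD.ae_mem] with y hy hq
      exact ⟨hy, (hD.p_pos hy (by simpa using hq) θ₀).ne'⟩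
  -- A countable family of estimates, fixed before the path-dependent `τ`, `σ` and `μ` are
  -- introduced.
  have hchern : ∀ᵐ ω ∂D.law, ∀ j j' n k : ℕ, ∀ᶠ N : ℕ in atTop, ∏ s ∈ Finset.range N,
      ENNReal.ofReal (Real.exp (1 / (n + 4 : ℝ) *
        logRatio (G.qm i) S (smallBall (Θ i) j n) (smallBall (Θ i) j' n) (ω s).1 ((ω s).2 i) -
        (ratioMoment (G.ν i) (G.q i) (G.qm i) S (1 / (n + 4 : ℝ)) (smallBall (Θ i) j n)
          (smallBall (Θ i) j' n) (ω s).1 - 1))) ≤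
      ENNReal.ofReal (Real.exp (1 / (k + 1 : ℝ) * N)) := by
    simp only [ae_all_iff]
    intro j j' n k
    refine D.ae_eventually_prod_le i (f := fun a y => ENNReal.ofReal (Real.exp (1 / (n + 4 : ℝ) *
        logRatio (G.qm i) S (smallBall (Θ i) j n) (smallBall (Θ i) j' n) a y -
        (ratioMoment (G.ν i) (G.q i) (G.qm i) S (1 / (n + 4 : ℝ)) (smallBall (Θ i) j n)
          (smallBall (Θ i) j' n) a - 1)))) ?_ (fun a => ?_) (by positivity)
    · have h1 := hD.measurable_logRatio (hcpt j n) (hne j n) (hne j' n)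
      have h2 := (hD.continuous_ratioMoment (hcpt j n) (hne j n) (hcpt j' n) (hne j' n) (ht n)
        (ht' n)).measurable.comp
        (measurable_fst : Measurable (Prod.fst : Profile A × Y i → Profile A))
      exact ((h1.const_mul _).sub (h2.sub_const 1)).exp.ennreal_ofReal
    · rw [hG.density_Q]
      exact hD.lintegral_exp_le_one (hcpt j n) (hne j n) (hcpt j' n) (hne j' n) (ht n) (ht' n) a
  filter_upwards [hgood, hchern] with ω hω hc τ σ μ hτ hσ hμ
  change (μ : Measure (Θ i)) (G.bestFit i σ)ᶜ = 0
  -- By second countability it suffices that each parameter outside the best fit has a null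
  -- neighbourhood; measurability of `bestFit` is not needed.
  refine measure_null_of_locally_null _ fun θ hθ => ?_
  obtain ⟨θ', hlt⟩ : ∃ θ', ∫ a, G.KL i θ' a ∂(σ : Measure (Profile A)) <
      ∫ a, G.KL i θ a ∂(σ : Measure (Profile A)) := by
    by_contra! h
    exact hθ h
  obtain ⟨j, hj, hjt⟩ := exists_smallBall θ
  obtain ⟨j', hj', hjt'⟩ := exists_smallBall θ'
  obtain ⟨n, hn⟩ := hD.exists_integral_ratioMoment_lt (σ : Measure (Profile A))
    (fun n => hcpt (j n) n) (fun n => hne (j n) n) (fun n => hcpt (j' n) n)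
    (fun n => hne (j' n) n) hjt hjt' hlt
  have hpos : (D.prior i : Measure (Θ i)) (smallBall (Θ i) (j' n) n) ≠ 0 := by
    have := hB.full_support i
    exact (Measure.measure_pos_of_mem_nhds _ (hj' n)).ne'
  have h0 := G.tendsto_posterior_zero hD (D.prior i) hω (hcpt (j n) n) (hne (j n) n)
    (isClosed_smallBall _ _ _).measurableSet (hcpt (j' n) n) (hne (j' n) n)
    (isClosed_smallBall _ _ _).measurableSet hpos (ht n) (ht' n) (hc (j n) (j' n) n) hτ hσ hn
  refine ⟨interior (smallBall (Θ i) (j n) n), mem_nhdsWithin_of_mem_nhds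
    (interior_mem_nhds.2 (hj n)), le_antisymm ?_ zero_le⟩
  -- The portmanteau inequality is for open sets, whereas vanishing belief was shown for the closed
  -- ball; hence the interior.
  refine (ProbabilityMeasure.le_liminf_measure_open_of_tendsto hμ isOpen_interior).trans ?_
  rw [← h0.liminf_eq]
  exact liminf_le_liminf (Eventually.of_forall fun k => measure_mono interior_subset)

end

/-! ### Limit profiles and rationalizability. -/

/-- Limits of empirical distributions are concentrated on the limit points of the sequence. -/
lemma ae_isLimitProfile {X : Type*} [TopologicalSpace X] [SecondCountableTopology X]
    [TopologicalSpace.PseudoMetrizableSpace X] [MeasurableSpace X] [BorelSpace X]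
    {a : ℕ → X} {τ : ℕ → ℕ} (hτ : StrictMono τ) {σ : ProbabilityMeasure X}
    (hσ : Tendsto (fun k => empirical a (τ k)) atTop (𝓝 σ)) :
    ∀ᵐ x ∂(σ : Measure X), IsLimitProfile a x := by
  change (σ : Measure X) {x | IsLimitProfile a x}ᶜ = 0
  refine measure_null_of_locally_null _ fun x hx => ?_
  have h1 : ¬ MapClusterPt x atTop a := fun h => hx <|
    h.tendsto_subseq
  rw [mapClusterPt_iff_frequently] at h1
  push Not at h1
  obtain ⟨V, hV, hVa⟩ := h1
  obtain ⟨U, hUV, hU, hxU⟩ := mem_nhds_iff.1 hV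
  obtain ⟨N, hN⟩ := eventually_atTop.1 hVa
  refine ⟨U, mem_nhdsWithin_of_mem_nhds (hU.mem_nhds hxU), le_antisymm ?_ zero_le⟩
  -- After time `N` the path never enters `U`, so at most `N` visits are averaged over `n + 1`
  -- periods.
  have hb : ∀ n, (empirical a n : Measure X) U ≤ ((n + 1 : ℕ) : ℝ≥0∞)⁻¹ * N := by
    intro n
    have h2 : (empirical a n : Measure X) U =
        ((n + 1 : ℕ) : ℝ≥0∞)⁻¹ * ∑ s ∈ Finset.range (n + 1), U.indicator 1 (a s) := by
      simp only [empirical, ProbabilityMeasure.coe_mk, Measure.smul_apply,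
        Measure.finsetSum_apply, Measure.dirac_apply' _ hU.measurableSet, smul_eq_mul]
    rw [h2]
    gcongr
    calc ∑ s ∈ Finset.range (n + 1), U.indicator (1 : X → ℝ≥0∞) (a s)
        ≤ ∑ s ∈ Finset.range (n + 1), if s ∈ Finset.range N then 1 else 0 := by
          refine Finset.sum_le_sum fun s _ => ?_
          by_cases hs : s < N
          · rw [if_pos (Finset.mem_range.2 hs)]
            exact Set.indicator_le_self _ _ _
          · rw [Set.indicator_of_notMem fun h => hN s (not_lt.1 hs) (hUV h)]
            exact zero_le
      _ ≤ N := by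
          rw [Finset.sum_ite_mem, Finset.sum_const, nsmul_eq_mul, mul_one]
          exact_mod_cast (Finset.card_le_card Finset.inter_subset_right).trans
            (Finset.card_range N).le
  have h3 : Tendsto (fun k => ((τ k + 1 : ℕ) : ℝ≥0∞)⁻¹ * N) atTop (𝓝 0) := by
    have h4 := ENNReal.tendsto_inv_nat_nhds_zero.comp
      ((tendsto_add_atTop_nat 1).comp hτ.tendsto_atTop)
    simpa using ENNReal.Tendsto.mul_const h4 (b := (N : ℝ≥0∞)) (Or.inr (ENNReal.natCast_ne_top N))
  refine (ProbabilityMeasure.le_liminf_measure_open_of_tendsto hσ hU).trans ?_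
  rw [← h3.liminf_eq]
  exact liminf_le_liminf (Eventually.of_forall fun k => hb (τ k))

/-- Almost surely, all limit action profiles are Berk-Nash rationalizable. -/
theorem Dynamics.Bayesian.ae_rationalizable {I : Type*} {A Y Θ : I → Type*}
    [∀ i, MeasurableSpace (A i)] [∀ i, MeasurableSpace (Y i)] [∀ i, MeasurableSpace (Θ i)]
    [∀ i, TopologicalSpace (A i)] [∀ i, PseudoMetricSpace (Θ i)] {G : Game A Y Θ}
    [Countable I] [DecidableEq I] [∀ i, SecondCountableTopology (A i)] [∀ i, BorelSpace (A i)]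
    [∀ i, TopologicalSpace.PseudoMetrizableSpace (A i)] [∀ i, T2Space (A i)]
    [∀ i, CompactSpace (A i)] [∀ i, BorelSpace (Θ i)] [∀ i, CompactSpace (Θ i)] [∀ i, T2Space (Θ i)]
    [∀ i, SecondCountableTopology (Θ i)] [∀ i, Nonempty (Θ i)] (hG : G.Regular)
    {D : Dynamics G} (hB : D.Bayesian) (hC : D.Consistent) :
    ∀ᵐ ω ∂D.law, ∀ z, IsLimitProfile (fun n => (ω n).1) z → G.Rationalizable z := by
  have h1 : ∀ᵐ ω ∂D.law, ∀ i, _ := ae_all_iff.2 fun i => hB.ae_bestFit_of_tendsto hG i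
  filter_upwards [h1, hB.ae_mem_bestResponse hG] with ω hfit hbest z hz
  refine ⟨{x | IsLimitProfile (fun n => (ω n).1) x}, hz, ?_⟩
  rintro x ⟨τ, hτ, hx⟩
  -- The product of all the spaces of distributions and beliefs is compact, so one subsequence
  -- serves all players at once.
  obtain ⟨⟨σ, μ⟩, φ, hφ, hlim⟩ := CompactSpace.tendsto_subseq
    fun k => (empirical (fun n => (ω n).1) (τ k),
      fun i => G.posterior i (D.prior i) (τ k) fun s => ω s)
  have hσ : Tendsto (fun k => empirical (fun n => (ω n).1) ((τ ∘ φ) k)) atTop (𝓝 σ) :=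
    (continuous_fst.tendsto _).comp hlim
  have hμ : ∀ i, Tendsto (fun k => G.posterior i (D.prior i) ((τ ∘ φ) k) fun s => ω s) atTop
      (𝓝 (μ i)) :=
    tendsto_pi_nhds.1 ((continuous_snd.tendsto _).comp hlim)
  have hτφ := hτ.comp hφ
  refine ⟨σ, ae_isLimitProfile hτφ hσ, fun i => ⟨μ i, hfit i _ σ (μ i) hτφ hσ (hμ i), ?_⟩⟩
  have hx' : Tendsto (fun k => (ω ((τ ∘ φ) k)).1 i) atTop (𝓝 (x i)) :=
    tendsto_pi_nhds.1 (hx.comp hφ.tendsto_atTop) i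
  exact hG.bestResponse_of_tendsto i hx' (hμ i) (hC _ _ hτφ σ hσ i) fun k => hbest i _

end BerkNash

/-! ### Euclidean action, consequence and parameter sets, and passage to the law of the action path.
-/

theorem mainTheorem1 {I : Type*} [Fintype I] [DecidableEq I] {dA dY dΘ : I → ℕ}
    (A : ∀ i, Set (EuclideanSpace ℝ (Fin (dA i))))
    (Y : ∀ i, Set (EuclideanSpace ℝ (Fin (dY i))))
    (Θ : ∀ i, Set (EuclideanSpace ℝ (Fin (dΘ i))))
    (hA : ∀ i, IsCompact (A i)) (hA' : ∀ i, (A i).Nonempty)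
    (hΘ : ∀ i, IsCompact (Θ i)) (hΘ' : ∀ i, (Θ i).Nonempty)
    (hY : ∀ i, MeasurableSet (Y i))
    (G : BerkNash.Game (fun i => A i) (fun i => Y i) (fun i => Θ i)) (hG : G.Regular)
    (D : BerkNash.Dynamics G) (hB : D.Bayesian) (hC : D.Consistent) :
    ∀ᵐ a ∂D.actionLaw, ∀ z, BerkNash.IsLimitProfile a z → G.Rationalizable z := by
  have : ∀ i, CompactSpace (A i) := fun i => isCompact_iff_compactSpace.1 (hA i)
  have : ∀ i, CompactSpace (Θ i) := fun i => isCompact_iff_compactSpace.1 (hΘ i)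
  have : ∀ i, Nonempty (Θ i) := fun i => (hΘ' i).to_subtype
  have : ∀ i, StandardBorelSpace (A i) := fun i => (hA i).measurableSet.standardBorel
  have : ∀ i, StandardBorelSpace (Y i) := fun i => (hY i).standardBorel
  exact BerkNash.ae_map_of_ae_comp (by fun_prop) (hB.ae_rationalizable hG hC)
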